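/- A group is locally finite if all its finitely generated subgroups are finite. Hall's group is the Fraïssé limit of the class of finite groups, i.e. the countable locally finite group $G$ (unique up to isomorphism) such that for all finite groups $A,B$ and injective homomorphisms $\iota:A\to B$, $\rho:A\to G$ there is an injective homomorphism $\sigma:B\to G$ with $\sigma\circ\iota=\rho$. The rational Urysohn space is the Fraïssé limit of the class of finite metric spaces with rational distances, i.e. the countable metric space $D$ with rational distances (unique up to isometry) such that for all finite metric spaces $A,B$ with rational distances and isometric embeddings $\iota:A\to B$, $\rho:A\to D$ there is an isometric embedding $\sigma:B\to D$ with $\sigma\circ\iota=\rho$. The Urysohn space $\mathbb{U}$ is its completion. For a metric space $X$ with a base point $o$, the Lipschitz-free space $F(X)$ is the closed linear span of the evaluation functionals $f\mapsto f(x)$, $x\in X$, in the dual of the Banach space $\mathrm{Lip}_0(X)$ of real Lipschitz functions vanishing at $o$, normed by the least Lipschitz constant. The Holmes space is $F(\mathbb{U})$. **Corollary (Holmes space).** Hall's group $G$ and the Urysohn space $\mathbb{U}$ exist and, for every choice of the base point of $\mathbb{U}$, there is an action $\alpha$ of $G$ on the Holmes space $F(\mathbb{U})$ by affine isometries such that the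 following holds. For every countable locally finite group $H$, every separable real Banach space $Y$ and every action of $H$ on $Y$ by (surjective) isometries there are a subgroup $H'\le G$, a group isomorphism $e:H\to H'$ and an isometric embedding $j:Y\to F(\mathbb{U})$ (as metric spaces; $j$ need not be affine) with $$j(h\cdot y)=\alpha(e(h))\,j(y)\qquad\text{for all } h\in H,\ y\in Y.$$ -/

import Mathlib

/-- A group is locally finite if all its finitely generated subgroups are finite. -/
def IsLocallyFiniteGroup (G : Type*) [Group G] : Prop :=
  ∀ K : Subgroup G, K.FG → Finite K

/-- `G` is Hall's universal locally finite group, i.e. the Fraïssé limit of the class of finite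
groups: it is countable, locally finite, and has the extension property for finite groups.
(With `A` trivial, the extension property says that every finite group embeds into `G`.) -/
structure IsHallGroup (G : Type*) [Group G] : Prop where
  countable : Countable G
  locallyFinite : IsLocallyFiniteGroup G
  extension : ∀ (A B : Type) [Group A] [Group B] [Finite A] [Finite B]
    (ι : A →* B) (ρ : A →* G), Function.Injective ι → Function.Injective ρ →
      ∃ σ : B →* G, Function.Injective σ ∧ σ.comp ι = ρ

/-- All distances in the metric space are rational numbers. -/
def HasRationalDistances (X : Type*) [MetricSpace X] : Prop :=
  ∀ x y : X, ∃ q : ℚ, dist x y = q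

/-- `D` is the rational Urysohn space, i.e. the Fraïssé limit of the class of finite metric spaces
with rational distances.  (With `A` empty, the extension property says that every finite rational
metric space embeds into `D`.) -/
structure IsRationalUrysohnSpace (D : Type*) [MetricSpace D] : Prop where
  countable : Countable D
  rational : HasRationalDistances D
  extension : ∀ (A B : Type) [MetricSpace A] [MetricSpace B] [Finite A] [Finite B],
    HasRationalDistances A → HasRationalDistances B →
    ∀ (ι : A → B) (ρ : A → D), Isometry ι → Isometry ρ →
      ∃ σ : B → D, Isometry σ ∧ σ ∘ ι = ρ

/-- `U` is the Urysohn universal space: the completion of the rational Urysohn space, i.e. a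
complete metric space with a dense copy of the rational Urysohn space. -/
structure IsUrysohnSpace (U : Type*) [MetricSpace U] : Prop where
  complete : CompleteSpace U
  exists_dense : ∃ D : Set U, Dense D ∧ IsRationalUrysohnSpace D

/-- The linear space of real Lipschitz functions on `X` that vanish at the base point `o`. -/
def lipZeroSubmodule (X : Type*) [MetricSpace X] (o : X) : Submodule ℝ (X → ℝ) where
  carrier := {f | f o = 0 ∧ ∃ K : NNReal, LipschitzWith K f}
  zero_mem' := ⟨rfl, 0, LipschitzWith.const 0⟩
  add_mem' := by
    rintro f g ⟨hf, K, hK⟩ ⟨hg, L, hL⟩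
    exact ⟨by simp [hf, hg], K + L, hK.add hL⟩
  smul_mem' := by
    rintro c f ⟨hf, K, hK⟩
    refine ⟨by simp [hf], ‖c‖₊ * K, LipschitzWith.of_dist_le_mul fun x y => ?_⟩
    have h := hK.dist_le_mul x y
    simp only [Pi.smul_apply, dist_smul₀, NNReal.coe_mul, coe_nnnorm, mul_assoc]
    exact mul_le_mul_of_nonneg_left h (norm_nonneg c)

/-- `Lip₀(X, o)`: real Lipschitz functions on `X` vanishing at `o`, to be normed by the best
Lipschitz constant. -/
def LipZero (X : Type*) [MetricSpace X] (o : X) : Type _ := ↥(lipZeroSubmodule X o)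

namespace LipZero

variable {X : Type*} [MetricSpace X] {o : X}

instance : AddCommGroup (LipZero X o) := inferInstanceAs (AddCommGroup ↥(lipZeroSubmodule X o))

instance : Module ℝ (LipZero X o) := inferInstanceAs (Module ℝ ↥(lipZeroSubmodule X o))

instance : CoeFun (LipZero X o) (fun _ => X → ℝ) := ⟨fun f => f.1⟩

@[simp] theorem add_apply (f g : LipZero X o) (x : X) : (f + g) x = f x + g x := rfl

@[simp] theorem smul_apply (c : ℝ) (f : LipZero X o) (x : X) : (c • f) x = c * f x := rfl

@[simp] theorem zero_apply (x : X) : (0 : LipZero X o) x = 0 := rfl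

theorem apply_base (f : LipZero X o) : f o = 0 := f.2.1

theorem ext_apply {f g : LipZero X o} (h : ∀ x, f x = g x) : f = g := Subtype.ext (funext h)

/-- The set of all Lipschitz constants of `f`. -/
def lipConstants (f : LipZero X o) : Set ℝ :=
  {K | 0 ≤ K ∧ ∀ x y, |f x - f y| ≤ K * dist x y}

/-- The norm of `Lip₀(X, o)`: the least Lipschitz constant. -/
noncomputable instance : Norm (LipZero X o) := ⟨fun f => sInf (lipConstants f)⟩

theorem norm_def (f : LipZero X o) : ‖f‖ = sInf (lipConstants f) := rfl

theorem lipConstants_nonempty (f : LipZero X o) : (lipConstants f).Nonempty := by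
  obtain ⟨K, hK⟩ := f.2.2
  exact ⟨K, K.2, fun x y => by simpa [Real.dist_eq] using hK.dist_le_mul x y⟩

theorem lipConstants_bddBelow (f : LipZero X o) : BddBelow (lipConstants f) :=
  ⟨0, fun _ hK => hK.1⟩

theorem norm_nonneg' (f : LipZero X o) : 0 ≤ ‖f‖ :=
  Real.sInf_nonneg fun _ hK => hK.1

theorem abs_sub_le (f : LipZero X o) (x y : X) : |f x - f y| ≤ ‖f‖ * dist x y := by
  rcases eq_or_lt_of_le (dist_nonneg (x := x) (y := y)) with h | h
  · obtain ⟨K, hK⟩ := lipConstants_nonempty f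
    have := hK.2 x y
    rw [← h, mul_zero] at this ⊢
    exact this
  · rw [← div_le_iff₀ h]
    exact le_csInf (lipConstants_nonempty f) fun K hK => (div_le_iff₀ h).2 (hK.2 x y)

theorem norm_le {f : LipZero X o} {K : ℝ} (hK : 0 ≤ K)
    (h : ∀ x y, |f x - f y| ≤ K * dist x y) : ‖f‖ ≤ K :=
  csInf_le (lipConstants_bddBelow f) ⟨hK, h⟩

theorem norm_smul_le' (c : ℝ) (f : LipZero X o) : ‖c • f‖ ≤ |c| * ‖f‖ := by
  refine norm_le (mul_nonneg (abs_nonneg c) (norm_nonneg' f)) fun x y => ?_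
  rw [smul_apply, smul_apply, ← mul_sub, abs_mul, mul_assoc]
  exact mul_le_mul_of_nonneg_left (abs_sub_le f x y) (abs_nonneg c)

theorem normCore : NormedSpace.Core ℝ (LipZero X o) where
  norm_nonneg := norm_nonneg'
  norm_smul c f := by
    refine le_antisymm (norm_smul_le' c f) ?_
    rcases eq_or_ne c 0 with rfl | hc
    · simpa using norm_nonneg' _
    · have h := norm_smul_le' c⁻¹ (c • f)
      rw [inv_smul_smul₀ hc, abs_inv, inv_mul_eq_div, le_div_iff₀ (abs_pos.2 hc)] at h
      rw [Real.norm_eq_abs, mul_comm]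
      exact h
  norm_triangle f g := by
    refine norm_le (add_nonneg (norm_nonneg' f) (norm_nonneg' g)) fun x y => ?_
    calc |(f + g) x - (f + g) y| = |(f x - f y) + (g x - g y)| := by
          rw [add_apply, add_apply]; congr 1; ring
      _ ≤ |f x - f y| + |g x - g y| := abs_add_le _ _
      _ ≤ (‖f‖ + ‖g‖) * dist x y := by
          rw [add_mul]; exact add_le_add (abs_sub_le f x y) (abs_sub_le g x y)
  norm_eq_zero_iff f := by
    constructor
    · intro h
      refine ext_apply fun x => ?_
      have h1 := abs_sub_le f x o
      rw [h, zero_mul, apply_base, sub_zero] at h1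
      exact abs_eq_zero.1 (le_antisymm h1 (abs_nonneg _))
    · rintro rfl
      exact le_antisymm (norm_le le_rfl (by simp)) (norm_nonneg' _)

noncomputable instance : NormedAddCommGroup (LipZero X o) := NormedAddCommGroup.ofCore normCore

noncomputable instance : NormedSpace ℝ (LipZero X o) := NormedSpace.ofCore normCore

/-- The evaluation functional `f ↦ f x` on `Lip₀(X, o)`. -/
noncomputable def eval (o x : X) : StrongDual ℝ (LipZero X o) :=
  LinearMap.mkContinuous
    { toFun := fun f => f x
      map_add' := fun _ _ => rfl
      map_smul' := fun _ _ => rfl }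
    (dist x o) (fun f => by
      have h := abs_sub_le f x o
      rw [apply_base, sub_zero, mul_comm] at h
      exact h)

end LipZero

/-- The Lipschitz-free Banach space `F(X)` over the pointed metric space `(X, o)`: the closed
linear span of the evaluation functionals in the dual of `Lip₀(X, o)`. -/
abbrev LipschitzFreeSpace (X : Type*) [MetricSpace X] (o : X) : Type _ :=
  ↥((Submodule.span ℝ (Set.range (LipZero.eval o))).topologicalClosure)

/-- The group (under composition) of all affine isometries of the real normed space `E` onto
itself. -/
abbrev AffineIsometryGroup (E : Type*) [NormedAddCommGroup E] [NormedSpace ℝ E] : Type _ :=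
  E ≃ᵃⁱ[ℝ] E

/-!
Let `G` be Hall's group. By meeting countably many dense conditions one finds an invariant rational
metric on the countable set `G × ℕ`, where `G` acts by left translations, which has the extension
properties of a Fraïssé limit: orbits can be added and finite subgroups can be enlarged.
Enlarging a subgroup requires amalgamating finite groups together with invariant metrics. By normal
forms, the shortest-path metric of the amalgamated free product restricts correctly to the factors.
This survives in a finite quotient which is faithful on a large enough ball, and the extension
property of `G` brings such a finite amalgam into `G`.

With the generic metric `G × ℕ` is the rational Urysohn space, so by uniqueness `𝕌` is its
completion and `G` acts on `𝕌`. If `H` is countable and locally finite, then `H × ℕ` with any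
invariant rational metric embeds equivariantly into `G × ℕ`, one finite piece after the other. The
orbits of an arbitrary isometric action of `H` on a separable space are approximated by such free
rational actions, and limits in the complete space `𝕌` give an equivariant isometric embedding.
Finally, an isometry `g` of `𝕌` acts on `F(𝕌)` by the affine isometry sending each `δ x` to
`δ (g x)`.
-/

open Equiv Filter Topology

/-- The action on `E` given by `ρ` is free: only the identity has a fixed point. -/
def ActsFreely {A E : Type*} [Group A] (ρ : A →* Perm E) : Prop :=
  ∀ a e, ρ a e = e → a = 1

/-- The action of `B` on `B × F`, a disjoint union of copies of `B` indexed by `F`, by left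
translations. -/
def translationPerm (B F : Type*) [Group B] : B →* Perm (B × F) where
  toFun b := (Equiv.mulLeft b).prodCongr (Equiv.refl F)
  map_one' := by ext x <;> simp
  map_mul' a b := by ext x <;> simp [mul_assoc]

theorem actsFreely_translationPerm (B F : Type*) [Group B] : ActsFreely (translationPerm B F) :=
  fun _ _ h => mul_eq_right.1 (congrArg Prod.fst h)

theorem exists_permHom_of_injective {L T X : Type*} [Group L] (τ : L →* Perm X) {f : T → X}
    (hf : Function.Injective f) (h : ∀ g t, τ g (f t) ∈ Set.range f) :
    ∃ π : L →* Perm T, ∀ g t, f (π g t) = τ g (f t) := by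
  choose m hm using h
  exact ⟨MonoidHom.toHomPerm
    { toFun := m
      map_one' := funext fun t => hf (show f (m 1 t) = f t by simp [hm])
      map_mul' := fun a b => funext fun t => hf (show f (m (a * b) t) = f (m a (m b t)) by
        simp [hm]) }, hm⟩

namespace ActsFreely

variable {A B E F : Type*} [Group A] [Group B]

theorem comp {ρ : B →* Perm E} (hρ : ActsFreely ρ) {ι : A →* B} (hι : Function.Injective ι) :
    ActsFreely (ρ.comp ι) :=
  fun _ e h => (map_eq_one_iff ι hι).1 (hρ _ e h)

theorem injective [Nonempty E] {ρ : A →* Perm E} (hρ : ActsFreely ρ) : Function.Injective ρ :=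
  (injective_iff_map_eq_one ρ).2 fun a ha => by
    obtain ⟨e⟩ := ‹Nonempty E›
    exact hρ a e (by rw [ha, Perm.one_apply])

theorem exists_equiv_prod.{u, v} {A : Type u} {E : Type v} [Group A] {ρ : A →* Perm E}
    (hρ : ActsFreely ρ) :
    ∃ (Q : Type v) (θ : A × Q ≃ E), ∀ a b q, θ (a * b, q) = ρ a (θ (b, q)) := by
  let _ : MulAction A E := MulAction.compHom E ρ
  let Q := MulAction.orbitRel.Quotient A E
  have act_inv_mul {a b : A} {x y : E} (h : ρ a x = ρ b y) : ρ (b⁻¹ * a) x = y := by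
    rw [map_mul, Perm.mul_apply, h, map_inv, Perm.inv_def, symm_apply_apply]
  refine ⟨Q, Equiv.ofBijective (fun p => ρ p.1 p.2.out) ⟨?_, fun e => ?_⟩, fun a b q => ?_⟩
  · rintro ⟨a, q⟩ ⟨b, r⟩ (h : ρ a q.out = ρ b r.out)
    have same_orbit : r = q := by
      rw [← Quotient.out_eq q, ← Quotient.out_eq r]
      exact Quotient.sound ⟨b⁻¹ * a, act_inv_mul h⟩
    subst same_orbit
    rw [inv_mul_eq_one.1 (hρ _ _ (act_inv_mul h))]
  · obtain ⟨a, ha⟩ : (⟦e⟧ : Q).out ∈ MulAction.orbit A e :=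
      Quotient.mk_out (s := MulAction.orbitRel A E) e
    exact ⟨(a⁻¹, ⟦e⟧), inv_smul_eq_iff.2 ha.symm⟩
  · change ρ (a * b) q.out = ρ a (ρ b q.out)
    rw [map_mul, Perm.mul_apply]

theorem exists_equivariant_equiv [Finite A] [Finite E] [Finite F] {ρ : A →* Perm E}
    {σ : A →* Perm F} (hρ : ActsFreely ρ) (hσ : ActsFreely σ) (hcard : Nat.card E = Nat.card F) :
    ∃ θ : E ≃ F, ∀ a e, θ (ρ a e) = σ a (θ e) := by
  obtain ⟨Q, u, hu⟩ := hρ.exists_equiv_prod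
  obtain ⟨R, v, hv⟩ := hσ.exists_equiv_prod
  have : Finite Q := Finite.of_injective (fun q => u (1, q)) fun q r h => by simpa using h
  have : Finite R := Finite.of_injective (fun q => v (1, q)) fun q r h => by simpa using h
  have card_orbits : Nat.card Q = Nat.card R := by
    rw [← Nat.card_congr u, ← Nat.card_congr v, Nat.card_prod, Nat.card_prod] at hcard
    exact Nat.eq_of_mul_eq_mul_left Nat.card_pos hcard
  obtain ⟨t⟩ := Finite.card_eq.1 card_orbits
  refine ⟨(u.symm.trans ((Equiv.refl A).prodCongr t)).trans v, fun a e => ?_⟩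
  obtain ⟨⟨b, q⟩, rfl⟩ := u.surjective e
  simp [← hu, hv]

theorem exists_extension [Finite B] [Finite E] {ι : A →* B} (hι : Function.Injective ι)
    {ρ : A →* Perm E} (hρ : ActsFreely ρ) (hcard : Nat.card B ∣ Nat.card E) :
    ∃ σ : B →* Perm E, (∀ a, σ (ι a) = ρ a) ∧ ActsFreely σ := by
  obtain ⟨m, hm⟩ := hcard
  have : Finite A := Finite.of_injective ι hι
  obtain ⟨θ, hθ⟩ := hρ.exists_equivariant_equiv
    ((actsFreely_translationPerm B (Fin m)).comp hι) (by simp [hm])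
  refine ⟨θ.symm.permCongrHom.toMonoidHom.comp (translationPerm B (Fin m)),
    fun a => Equiv.ext fun e => ?_, fun b e h => ?_⟩
  · exact (Equiv.symm_apply_eq θ).2 (hθ a e).symm
  · exact actsFreely_translationPerm B (Fin m) b (θ e) ((Equiv.symm_apply_eq θ).1 h)

theorem exists_extension_of_subtype [Finite B] [Finite E] {ι : A →* B}
    (hι : Function.Injective ι) {ρ : A →* Perm E} (hρ : ActsFreely ρ) {p : E → Prop}
    (π : B →* Perm {e // p e}) (hπ : ∀ a e, (π (ι a) e : E) = ρ a e)
    (hcard : Nat.card B ∣ Nat.card {e // ¬ p e}) :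
    ∃ σ : B →* Perm E, (∀ a, σ (ι a) = ρ a) ∧ ∀ b (e : {e // p e}), σ b e = π b e := by
  classical
  have hp_of (a : A) {e : E} (he : p e) : p (ρ a e) := hπ a ⟨e, he⟩ ▸ (π (ι a) ⟨e, he⟩).2
  have hp (a : A) (e : E) : p (ρ a e) ↔ p e := ⟨fun h => by simpa using hp_of a⁻¹ h, hp_of a⟩
  let ρ' : A →* Perm {e // ¬ p e} :=
    { toFun := fun a => (ρ a).subtypePerm fun e => not_congr (hp a e)
      map_one' := by ext; simp
      map_mul' := fun a b => by ext e; exact congrArg (· e.1) (ρ.map_mul a b) }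
  have hρ' : ActsFreely ρ' := fun a e h => hρ a e (congrArg Subtype.val h)
  obtain ⟨σ', hσ', -⟩ := hρ'.exists_extension hι hcard
  refine ⟨(Perm.subtypeCongrHom p).comp (π.prod σ'), fun a => ?_, fun b e => ?_⟩
  · ext e
    by_cases he : p e
    · simp [Perm.subtypeCongrHom, he, hπ]
    · simp [Perm.subtypeCongrHom, he, hσ', ρ']
  · simp [Perm.subtypeCongrHom, e.2]

end ActsFreely

/-- `w` encodes a metric on `K × I` which is invariant under left translations by the subgroup `K`:
the distance between `(h, i)` and `(h * g, j)` is `w g i j`. The values of `w` outside of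
`K × I × I` are irrelevant. -/
structure IsInvMetricOn {G ι R : Type*} [Group G] [AddCommMonoid R] [PartialOrder R]
    (K : Subgroup G) (I : Set ι) (w : G → ι → ι → R) : Prop where
  eq_zero_iff : ∀ g ∈ K, ∀ i ∈ I, ∀ j ∈ I, (w g i j = 0 ↔ g = 1 ∧ i = j)
  symm : ∀ g ∈ K, ∀ i ∈ I, ∀ j ∈ I, w g⁻¹ j i = w g i j
  triangle : ∀ g ∈ K, ∀ h ∈ K, ∀ i ∈ I, ∀ j ∈ I, ∀ k ∈ I, w (g * h) i k ≤ w g i j + w h j k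

/-- `w` encodes a left invariant metric on `G × ι`, as in `IsInvMetricOn`. -/
abbrev IsInvMetric {G ι R : Type*} [Group G] [AddCommMonoid R] [PartialOrder R]
    (w : G → ι → ι → R) : Prop :=
  IsInvMetricOn ⊤ Set.univ w

namespace IsInvMetric

variable {G ι R : Type*} [Group G] [AddCommMonoid R] [PartialOrder R] {w : G → ι → ι → R}

theorem mk (eq_zero_iff : ∀ g i j, w g i j = 0 ↔ g = 1 ∧ i = j)
    (symm : ∀ g i j, w g⁻¹ j i = w g i j)
    (triangle : ∀ g h i j k, w (g * h) i k ≤ w g i j + w h j k) : IsInvMetric w :=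
  ⟨fun g _ i _ j _ => eq_zero_iff g i j, fun g _ i _ j _ => symm g i j,
    fun g _ h _ i _ j _ k _ => triangle g h i j k⟩

theorem eq_zero_iff (hw : IsInvMetric w) {g : G} {i j : ι} : w g i j = 0 ↔ g = 1 ∧ i = j :=
  IsInvMetricOn.eq_zero_iff hw g trivial i trivial j trivial

theorem symm (hw : IsInvMetric w) (g : G) (i j : ι) : w g⁻¹ j i = w g i j :=
  IsInvMetricOn.symm hw g trivial i trivial j trivial

theorem triangle (hw : IsInvMetric w) (g h : G) (i j k : ι) :
    w (g * h) i k ≤ w g i j + w h j k :=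
  IsInvMetricOn.triangle hw g trivial h trivial i trivial j trivial k trivial

end IsInvMetric

/-- `WPath ψ w c x i n`: multiplying letters from the groups `L k`, the letter `g : L k` from `i` to
`j` costing `w k g i j`, one can get from the point `(1, i)` to the point `(x, c)` at total cost
`n`. -/
inductive WPath {κ ι Γ : Type*} {L : κ → Type*} [∀ k, Group (L k)] [Group Γ]
    (ψ : ∀ k, L k →* Γ) (w : ∀ k, L k → ι → ι → ℕ) (c : ι) : Γ → ι → ℕ → Prop
  | nil : WPath ψ w c 1 c 0
  | cons {x : Γ} {j : ι} {n : ℕ} (k : κ) (g : L k) (i : ι) (h : WPath ψ w c x j n) :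
      WPath ψ w c (ψ k g * x) i (w k g i j + n)

namespace WPath

variable {κ ι Γ : Type*} {L : κ → Type*} [∀ k, Group (L k)] [Group Γ]
    {ψ : ∀ k, L k →* Γ} {w : ∀ k, L k → ι → ι → ℕ}

theorem single (k : κ) (g : L k) (i j : ι) : WPath ψ w j (ψ k g) i (w k g i j) := by
  simpa using WPath.cons k g i (WPath.nil (ψ := ψ) (w := w) (c := j))

theorem append {c d : ι} {x y : Γ} {i : ι} {m n : ℕ} (h : WPath ψ w c x i m)
    (h' : WPath ψ w d y c n) : WPath ψ w d (x * y) i (m + n) := by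
  induction h with
  | nil => simpa using h'
  | cons k g i h ih => rw [mul_assoc, add_assoc]; exact ih.cons k g i

theorem reverse (hw : ∀ k, IsInvMetric (w k)) {c : ι} {x : Γ} {i : ι} {n : ℕ}
    (h : WPath ψ w c x i n) : WPath ψ w i x⁻¹ c n := by
  induction h with
  | nil => simpa using WPath.nil
  | @cons x j n k g i _ ih =>
    have reversed := ih.append (single (ψ := ψ) (w := w) k g⁻¹ j i)
    rwa [(hw k).symm, map_inv, add_comm, ← mul_inv_rev] at reversed

theorem eq_of_zero (hw : ∀ k, IsInvMetric (w k)) {c : ι} {x : Γ} {i : ι} {n : ℕ}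
    (h : WPath ψ w c x i n) (hn : n = 0) : x = 1 ∧ i = c := by
  induction h with
  | nil => exact ⟨rfl, rfl⟩
  | @cons x j n k g i h ih =>
    obtain ⟨rfl, rfl⟩ := ih (by omega)
    obtain ⟨rfl, rfl⟩ := (hw k).eq_zero_iff.1 (show w k g i j = 0 by omega)
    simp

end WPath

/-- A path in the sense of `WPath` which is reduced with respect to the common subgroup `A` of the
groups `L k`: the letters alternate between the groups and, except possibly for the last one, which
comes from `L k₀`, lie outside of `A`. The path `ReducedWPath φ ψ w c k₀ k x i n` starts with a
letter from `L k`. -/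
inductive ReducedWPath {κ ι Γ A : Type*} {L : κ → Type*} [∀ k, Group (L k)] [Group Γ] [Group A]
    (φ : ∀ k, A →* L k) (ψ : ∀ k, L k →* Γ) (w : ∀ k, L k → ι → ι → ℕ) (c : ι) (k₀ : κ) :
    κ → Γ → ι → ℕ → Prop
  | base (g : L k₀) (i : ι) : ReducedWPath φ ψ w c k₀ k₀ (ψ k₀ g) i (w k₀ g i c)
  | cons {k' : κ} {x : Γ} {j : ι} {n : ℕ} (k : κ) (hk : k ≠ k') (g : L k) (hg : g ∉ (φ k).range)
      (i : ι) (h : ReducedWPath φ ψ w c k₀ k' x j n) :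
      ReducedWPath φ ψ w c k₀ k (ψ k g * x) i (w k g i j + n)

section Reduced

variable {κ ι Γ A : Type*} {L : κ → Type*} [∀ k, Group (L k)] [Group Γ] [Group A]
    {φ : ∀ k, A →* L k} {ψ : ∀ k, L k →* Γ} {w : ∀ k, L k → ι → ι → ℕ}

theorem ReducedWPath.absorb (hψ : ∀ k l a, ψ k (φ k a) = ψ l (φ l a))
    (hw : ∀ k, IsInvMetric (w k)) (hwA : ∀ k l a i j, w k (φ k a) i j = w l (φ l a) i j)
    {c : ι} {k₀ k : κ} {x : Γ} {j : ι} {n : ℕ} (h : ReducedWPath φ ψ w c k₀ k x j n)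
    (l : κ) (a : A) (i : ι) :
    ∃ n' ≤ w l (φ l a) i j + n, ReducedWPath φ ψ w c k₀ k (ψ l (φ l a) * x) i n' := by
  cases h with
  | base g =>
    refine ⟨w k₀ (φ k₀ a * g) i c, ?_, ?_⟩
    · rw [hwA l k₀]
      exact (hw k₀).triangle ..
    · rw [hψ l k₀, ← map_mul]
      exact .base _ _
  | @cons k' y j' n' _ hk g hg _ h =>
    refine ⟨w k (φ k a * g) i j' + n', ?_, ?_⟩
    · rw [hwA l k, ← add_assoc]
      exact Nat.add_le_add_right ((hw k).triangle ..) _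
    · rw [hψ l k, ← mul_assoc, ← map_mul]
      exact .cons k hk _ (mt (((φ k).range.mul_mem_cancel_left ⟨a, rfl⟩).1) hg) i h

theorem ReducedWPath.exists_mul (hψ : ∀ k l a, ψ k (φ k a) = ψ l (φ l a))
    (hw : ∀ k, IsInvMetric (w k)) (hwA : ∀ k l a i j, w k (φ k a) i j = w l (φ l a) i j)
    {c : ι} {k₀ k : κ} {x : Γ} {j : ι} {n : ℕ} (h : ReducedWPath φ ψ w c k₀ k x j n)
    (l : κ) (g : L l) (i : ι) :
    ∃ k', ∃ n' ≤ w l g i j + n, ReducedWPath φ ψ w c k₀ k' (ψ l g * x) i n' := by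
  by_cases hg : g ∈ (φ l).range
  · obtain ⟨a, rfl⟩ := hg
    exact ⟨k, h.absorb hψ hw hwA l a i⟩
  by_cases hlk : l = k
  · subst hlk
    cases h with
    | base g' => exact ⟨k₀, _, (hw k₀).triangle g g' i j c, map_mul (ψ k₀) g g' ▸ .base _ _⟩
    | @cons k' y j' n' _ hk g' hg' _ tail =>
      have htri := (hw l).triangle g g' i j j'
      rw [← mul_assoc, ← map_mul]
      by_cases hgg : g * g' ∈ (φ l).range
      · obtain ⟨a, ha⟩ := hgg
        obtain ⟨n'', hn'', path⟩ := tail.absorb hψ hw hwA l a i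
        rw [ha] at hn'' path
        exact ⟨k', n'', by omega, path⟩
      · exact ⟨l, _, by omega, .cons l hk _ hgg i tail⟩
  · exact ⟨l, _, le_rfl, .cons l hlk g hg i h⟩

theorem WPath.exists_reduced (hψ : ∀ k l a, ψ k (φ k a) = ψ l (φ l a))
    (hw : ∀ k, IsInvMetric (w k)) (hwA : ∀ k l a i j, w k (φ k a) i j = w l (φ l a) i j)
    {c : ι} (k₀ : κ) {x : Γ} {i : ι} {n : ℕ} (h : WPath ψ w c x i n) :
    ∃ k, ∃ n' ≤ n, ReducedWPath φ ψ w c k₀ k x i n' := by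
  induction h with
  | nil =>
    have trivial_letter : ReducedWPath φ ψ w c k₀ k₀ (ψ k₀ 1) c (w k₀ 1 c c) := .base 1 c
    rw [(hw k₀).eq_zero_iff.2 ⟨rfl, rfl⟩, map_one] at trivial_letter
    exact ⟨k₀, 0, le_rfl, trivial_letter⟩
  | @cons x j n l g i _ ih =>
    obtain ⟨k, m, hm, reduced⟩ := ih
    obtain ⟨k', n', hn', path⟩ := reduced.exists_mul hψ hw hwA l g i
    exact ⟨k', n', by omega, path⟩

end Reduced

section PushoutWords

open Monoid CoprodI

variable {κ ι A : Type*} {L : κ → Type*} [∀ k, Group (L k)] [Group A] {φ : ∀ k, A →* L k}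

theorem exists_reduced_word_of_mul {W : Word L} (hW : PushoutI.Reduced φ W) {k : κ} {g : L k}
    (hg : g ∉ (φ k).range) (hk : W.fstIdx ≠ some k) :
    ∃ W' : Word L, PushoutI.Reduced φ W' ∧ W'.fstIdx = some k ∧
      PushoutI.ofCoprodI (φ := φ) W'.prod = PushoutI.of k g * PushoutI.ofCoprodI W.prod := by
  have hg1 : g ≠ 1 := fun h => hg (h ▸ one_mem _)
  refine ⟨Word.cons g W hk hg1, ?_, Word.fstIdx_cons .., by simp⟩
  exact List.forall_mem_cons.2 ⟨hg, hW⟩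

theorem ReducedWPath.eq_of_or_exists_word {w : ∀ k, L k → ι → ι → ℕ} {c : ι} {k₀ k : κ}
    {x : PushoutI φ} {i : ι} {n : ℕ} (f : L k₀)
    (h : ReducedWPath φ (fun k => PushoutI.of k) w c k₀ k x i n) :
    (k = k₀ ∧ ∃ g, x = PushoutI.of k₀ g ∧ n = w k₀ g i c) ∨
      ∃ W : Word L, PushoutI.Reduced φ W ∧ W.fstIdx = some k ∧
        PushoutI.ofCoprodI W.prod = x * PushoutI.of k₀ f := by
  induction h with
  | base g i => exact Or.inl ⟨rfl, g, rfl, rfl⟩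
  | @cons k' y j' n' k hk g' hg' i h ih =>
    right
    have empty_reduced : PushoutI.Reduced φ (Word.empty : Word L) := fun _ h => nomatch h
    rcases ih with ⟨rfl, g, rfl, -⟩ | ⟨W, hW, hWk, hprod⟩
    · by_cases hgf : g * f ∈ (φ k').range
      · obtain ⟨a, ha⟩ := hgf
        obtain ⟨W, hW, hWk, hprod⟩ := exists_reduced_word_of_mul empty_reduced
          (mt ((φ k).range.mul_mem_cancel_right ⟨a, rfl⟩).1 hg') (by simp [Word.fstIdx, Word.empty])
        refine ⟨W, hW, hWk, ?_⟩
        simp only [hprod, mul_assoc, ← map_mul (PushoutI.of k'), ← ha, map_mul,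
          PushoutI.of_apply_eq_base, Word.prod_empty, map_one, mul_one]
      · obtain ⟨V, hV, hVk, hVprod⟩ := exists_reduced_word_of_mul empty_reduced hgf
          (by simp [Word.fstIdx, Word.empty])
        obtain ⟨W, hW, hWk, hprod⟩ :=
          exists_reduced_word_of_mul hV hg' (by simpa [hVk] using hk.symm)
        exact ⟨W, hW, hWk, by simp [hprod, hVprod, mul_assoc]⟩
    · obtain ⟨V, hV, hVk, hVprod⟩ :=
        exists_reduced_word_of_mul hW hg' (by simpa [hWk] using hk.symm)
      exact ⟨V, hV, hVk, by simp [hVprod, hprod, mul_assoc]⟩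

theorem ReducedWPath.le_of_eq_of (hφ : ∀ k, Function.Injective (φ k))
    {w : ∀ k, L k → ι → ι → ℕ} {c : ι} {k₀ k : κ} {x : PushoutI φ} {i : ι} {n : ℕ}
    (h : ReducedWPath φ (fun k => PushoutI.of k) w c k₀ k x i n)
    {g : L k₀} (hx : x = PushoutI.of k₀ g) : w k₀ g i c ≤ n := by
  rcases h.eq_of_or_exists_word g⁻¹ with ⟨rfl, g', hg', rfl⟩ | ⟨W, hW, hWk, hprod⟩
  · rw [PushoutI.of_injective hφ k (hx.symm.trans hg')]
  · have word_trivial : PushoutI.ofCoprodI (φ := φ) W.prod = 1 := by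
      rw [hprod, hx, map_inv, mul_inv_cancel]
    rw [hW.eq_empty_of_mem_range hφ (word_trivial ▸ one_mem _)] at hWk
    cases hWk

theorem WPath.le_of_pushout (hφ : ∀ k, Function.Injective (φ k)) {w : ∀ k, L k → ι → ι → ℕ}
    (hw : ∀ k, IsInvMetric (w k)) (hwA : ∀ k l a i j, w k (φ k a) i j = w l (φ l a) i j)
    {k : κ} {g : L k} {i c : ι} {n : ℕ}
    (h : WPath (fun k => PushoutI.of (φ := φ) k) w c (PushoutI.of k g) i n) : w k g i c ≤ n := by
  obtain ⟨k', n', hn', reduced⟩ :=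
    h.exists_reduced (φ := φ) (fun k l a => by simp only [PushoutI.of_apply_eq_base]) hw hwA k
  exact (reduced.le_of_eq_of hφ rfl).trans hn'

end PushoutWords

section Amalgam

universe u v x y

variable {κ : Type u} {L : κ → Type v} {A : Type x} {Γ : Type y} {ι : Type*}
  [∀ k, Group (L k)] [Group A] [Group Γ] {φ : ∀ k, A →* L k} {ψ : ∀ k, L k →* Γ}
  {w : ∀ k, L k → ι → ι → ℕ}

theorem exists_finite_permHoms_of_finite_subset [Finite κ] [∀ k, Finite (L k)]
    (hφ : ∀ k, Function.Injective (φ k)) {α : A →* Γ} (hα : Function.Injective α)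
    (hψ : ∀ k a, ψ k (φ k a) = α a) {E : Set Γ} (hE : E.Finite) (hne : E.Nonempty)
    (hαE : ∀ a, ∀ x ∈ E, α a * x ∈ E) :
    ∃ (Ω : Type (max u v y)) (_ : Finite Ω) (χ : ∀ k, L k →* Perm Ω) (e : Γ → Ω),
      (∀ k l a, χ k (φ k a) = χ l (φ l a)) ∧ Set.InjOn e E ∧
      ∀ k x, (∀ g, ψ k g * x ∈ E) → ∀ g, χ k g (e x) = e (ψ k g * x) := by
  classical
  have : Finite E := hE
  -- The factor `J` makes the order of each `L k` divide the number of remaining points.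
  let J : Type _ := ∀ k, L k
  let f : E × J → Γ × J := Prod.map Subtype.val id
  have hf : Function.Injective f := Subtype.val_injective.prodMap Function.injective_id
  obtain ⟨ρ, hρ⟩ := exists_permHom_of_injective ((translationPerm Γ J).comp α) hf
    fun a x => ⟨(⟨α a * x.1, hαE a _ x.1.2⟩, x.2), rfl⟩
  have ρ_free : ActsFreely ρ := fun a x h =>
    (actsFreely_translationPerm Γ J).comp hα a (f x) (by rw [← hρ, h])
  have extension : ∀ k, ∃ σ : L k →* Perm (E × J), (∀ a, σ (φ k a) = ρ a) ∧
      ∀ (x : E × J), (∀ g, ψ k g * x.1 ∈ E) → ∀ b, f (σ b x) = (ψ k b * x.1, x.2) := by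
    intro k
    let p : E → Prop := fun x => ∀ g, ψ k g * x ∈ E
    obtain ⟨π, hπ⟩ := exists_permHom_of_injective (T := {x : E × J // p x.1})
      ((translationPerm Γ J).comp (ψ k)) (hf.comp Subtype.val_injective) fun g x =>
        ⟨⟨(⟨ψ k g * x.1.1, x.2 g⟩, x.1.2), fun l => by
          simpa only [← mul_assoc, ← map_mul] using x.2 (l * g)⟩, rfl⟩
    obtain ⟨σ, hσρ, hσπ⟩ := ρ_free.exists_extension_of_subtype (hφ k) π
      (fun a x => hf ((hπ (φ k a) x).trans (by simp [hρ, hψ, f]))) (by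
        rw [Nat.card_congr (Equiv.prodSubtypeFstEquivSubtypeProd (p := fun x => ¬ p x)),
          Nat.card_prod]
        have := Fintype.ofFinite κ
        rw [Nat.card_pi]
        exact (Finset.dvd_prod_of_mem (fun k => Nat.card (L k)) (Finset.mem_univ k)).mul_left _)
    exact ⟨σ, hσρ, fun x hx b => (congrArg f (hσπ b ⟨x, hx⟩)).trans (hπ b ⟨x, hx⟩)⟩
  choose χ hχρ hχ using extension
  obtain ⟨x₀, hx₀⟩ := hne
  refine ⟨E × J, inferInstance, χ, fun x => if h : x ∈ E then (⟨x, h⟩, 1) else (⟨x₀, hx₀⟩, 1),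
    fun k l a => by rw [hχρ, hχρ], fun x hx y hy h => by simpa [hx, hy] using h, ?_⟩
  intro k x hx g
  have hxE : x ∈ E := by simpa using hx 1
  refine hf ((congrArg f ?_).trans ((hχ k (⟨x, hxE⟩, 1) hx g).trans ?_))
  · simp only [hxE, dite_true]
  · simp only [hx g, dite_true, f, Prod.map_apply, id_eq]

/-- The path distance defined by `WPath`, cut off at `R`. -/
noncomputable def truncatedPathDist (ψ : ∀ k, L k →* Γ) (w : ∀ k, L k → ι → ι → ℕ) (R : ℕ)
    (x : Γ) (i c : ι) : ℕ :=
  sInf {n | WPath ψ w c x i n ∨ R ≤ n}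

theorem wPath_truncatedPathDist_or_le (ψ : ∀ k, L k →* Γ) (w : ∀ k, L k → ι → ι → ℕ) (R : ℕ)
    (x : Γ) (i c : ι) :
    WPath ψ w c x i (truncatedPathDist ψ w R x i c) ∨ R ≤ truncatedPathDist ψ w R x i c :=
  Nat.sInf_mem (s := {n | WPath ψ w c x i n ∨ R ≤ n}) ⟨R, Or.inr le_rfl⟩

theorem WPath.truncatedPathDist_le {R n : ℕ} {x : Γ} {i c : ι} (h : WPath ψ w c x i n) :
    truncatedPathDist ψ w R x i c ≤ n :=
  Nat.sInf_le (Or.inl h)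

theorem truncatedPathDist_le_of_le {R n : ℕ} (x : Γ) (i c : ι) (h : R ≤ n) :
    truncatedPathDist ψ w R x i c ≤ n :=
  Nat.sInf_le (Or.inr h)

theorem isInvMetric_truncatedPathDist (hw : ∀ k, IsInvMetric (w k)) {R : ℕ} (hR : 0 < R) :
    IsInvMetric (truncatedPathDist ψ w R) := by
  have symm_le (x : Γ) (i j : ι) :
      truncatedPathDist ψ w R x⁻¹ j i ≤ truncatedPathDist ψ w R x i j := by
    rcases wPath_truncatedPathDist_or_le ψ w R x i j with path | hle
    · exact (path.reverse hw).truncatedPathDist_le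
    · exact truncatedPathDist_le_of_le _ _ _ hle
  refine IsInvMetric.mk (fun x i j => ⟨fun h => ?_, ?_⟩) (fun x i j => ?_) (fun x y i j k => ?_)
  · rcases wPath_truncatedPathDist_or_le ψ w R x i j with path | hle
    · exact path.eq_of_zero hw h
    · omega
  · rintro ⟨rfl, rfl⟩
    exact Nat.le_zero.1 WPath.nil.truncatedPathDist_le
  · exact le_antisymm (symm_le x i j) (by simpa using symm_le x⁻¹ j i)
  · rcases wPath_truncatedPathDist_or_le ψ w R x i j with path | hle
    · rcases wPath_truncatedPathDist_or_le ψ w R y j k with path' | hle'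
      · exact (path.append path').truncatedPathDist_le
      · exact truncatedPathDist_le_of_le _ _ _ (by omega)
    · exact truncatedPathDist_le_of_le _ _ _ (by omega)

open scoped Pointwise

theorem WPath.exists_lift {Ω : Type*} {χ : ∀ k, L k →* Perm Ω} {e : Γ → Ω}
    (hw : ∀ k, IsInvMetric (w k)) {S : Set Γ} (h1S : 1 ∈ S) (hψS : ∀ k g, ψ k g ∈ S) {R : ℕ}
    (he : ∀ n < R, ∀ k g, ∀ x ∈ S ^ n, χ k g (e x) = e (ψ k g * x)) {c i : ι} {x : Perm Ω} {n : ℕ}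
    (h : WPath χ w c x i n) (hn : n < R) :
    ∃ γ ∈ S ^ n, WPath ψ w c γ i n ∧ x (e 1) = e γ := by
  induction h with
  | nil => exact ⟨1, by simp, .nil, rfl⟩
  | @cons x j n k g i h ih =>
    obtain ⟨γ, hγ, path, hx⟩ := ih (by omega)
    refine ⟨ψ k g * γ, ?_, path.cons k g i, by rw [Perm.mul_apply, hx, he n (by omega) k g γ hγ]⟩
    rcases Nat.eq_zero_or_pos (w k g i j) with h0 | hpos
    · obtain ⟨rfl, rfl⟩ := (hw k).eq_zero_iff.1 h0
      simpa [h0] using hγ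
    · refine Set.pow_subset_pow_right h1S (m := n + 1) (by omega) ?_
      rw [pow_succ']
      exact Set.mul_mem_mul (hψS k g) hγ

open Monoid in
theorem WPath.le_of_local {Ω : Type*} {χ : ∀ k, L k →* Perm Ω} {e : PushoutI φ → Ω}
    (hφ : ∀ k, Function.Injective (φ k)) (hw : ∀ k, IsInvMetric (w k))
    (hwA : ∀ k l a i j, w k (φ k a) i j = w l (φ l a) i j) {S : Set (PushoutI φ)} (h1S : 1 ∈ S)
    (hS : ∀ k g, PushoutI.of k g ∈ S) {R : ℕ} (hinj : Set.InjOn e (S ^ R))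
    (he : ∀ n < R, ∀ k g, ∀ x ∈ S ^ n, χ k g (e x) = e (PushoutI.of k g * x))
    {k : κ} {g : L k} {i j : ι} {n : ℕ} (h : WPath χ w j (χ k g) i n) (hn : n < R) :
    w k g i j ≤ n := by
  obtain ⟨γ, hγ, path, hx⟩ := h.exists_lift hw h1S hS he hn
  have hγg : γ = PushoutI.of k g := by
    refine hinj (Set.pow_subset_pow_right h1S hn.le hγ)
      (Set.pow_subset_pow_right h1S (m := 1) (by omega) (by simpa using hS k g)) ?_
    rw [← hx, he 0 (by omega) k g 1 (by simp), mul_one]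
  exact (hγg ▸ path).le_of_pushout hφ hw hwA

open Monoid in
theorem exists_finite_permHoms_of_pushout [Finite κ] [∀ k, Finite (L k)] [Finite A]
    (hφ : ∀ k, Function.Injective (φ k)) (R : ℕ) :
    ∃ (Ω : Type (max u v x)) (_ : Finite Ω) (χ : ∀ k, L k →* Perm Ω) (e : PushoutI φ → Ω)
      (S : Set (PushoutI φ)), 1 ∈ S ∧ (∀ k g, PushoutI.of k g ∈ S) ∧
      (∀ k l a, χ k (φ k a) = χ l (φ l a)) ∧ Set.InjOn e (S ^ (R + 1)) ∧
      ∀ n < R + 1, ∀ k g, ∀ x ∈ S ^ n, χ k g (e x) = e (PushoutI.of k g * x) := by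
  let S : Set (PushoutI φ) := Set.range (PushoutI.base φ) ∪ ⋃ k, Set.range (PushoutI.of k)
  have base_mem (a : A) : PushoutI.base φ a ∈ S := Or.inl ⟨a, rfl⟩
  have of_mem (k : κ) (g : L k) : PushoutI.of k g ∈ S := Or.inr (Set.mem_iUnion.2 ⟨k, g, rfl⟩)
  have h1S : (1 : PushoutI φ) ∈ S := map_one (PushoutI.base φ) ▸ base_mem 1
  have S_finite : S.Finite :=
    (Set.finite_range _).union (Set.finite_iUnion fun k => Set.finite_range _)
  have pow_finite (n : ℕ) : (S ^ n).Finite := by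
    induction n with
    | zero => simp
    | succ n ih => exact pow_succ S n ▸ Set.Finite.mul ih S_finite
  have base_mul_mem (a : A) (x) (hx : x ∈ S) : PushoutI.base φ a * x ∈ S := by
    rcases hx with ⟨b, rfl⟩ | hx
    · exact map_mul (PushoutI.base φ) a b ▸ base_mem _
    · obtain ⟨k, g, rfl⟩ := Set.mem_iUnion.1 hx
      rw [← PushoutI.of_apply_eq_base φ k, ← map_mul]
      exact of_mem _ _
  obtain ⟨Ω, _, χ, e, hχ, hinj, he⟩ := exists_finite_permHoms_of_finite_subset hφ
    (PushoutI.base_injective hφ) (PushoutI.of_apply_eq_base φ) (pow_finite (R + 1))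
    ⟨1, Set.one_mem_pow h1S⟩ fun a x hx => by
      rw [pow_succ'] at hx ⊢
      obtain ⟨s, hs, t, ht, rfl⟩ := Set.mem_mul.1 hx
      exact mul_assoc (PushoutI.base φ a) s t ▸ Set.mul_mem_mul (base_mul_mem a s hs) ht
  refine ⟨Ω, ‹_›, χ, e, S, h1S, of_mem, hχ, hinj, fun n hn k g x hx => he k x (fun g => ?_) g⟩
  refine Set.pow_subset_pow_right h1S hn ?_
  rw [Nat.succ_eq_add_one, pow_succ']
  exact Set.mul_mem_mul (of_mem k g) hx

theorem exists_amalgam_nat [Finite κ] [∀ k, Finite (L k)] [Finite A] [Finite ι]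
    (hφ : ∀ k, Function.Injective (φ k)) (hw : ∀ k, IsInvMetric (w k))
    (hwA : ∀ k l a i j, w k (φ k a) i j = w l (φ l a) i j) :
    ∃ (D : Type (max u v x)) (_ : Group D) (_ : Finite D) (χ : ∀ k, L k →* D) (v : D → ι → ι → ℕ),
      (∀ k l a, χ k (φ k a) = χ l (φ l a)) ∧ IsInvMetric v ∧
      ∀ k g i j, v (χ k g) i j = w k g i j := by
  obtain ⟨R, hR⟩ : ∃ R, ∀ k g i j, w k g i j < R + 1 := by
    obtain ⟨R, hR⟩ := (Set.finite_range
      (fun x : (Σ k, L k) × ι × ι => w x.1.1 x.1.2 x.2.1 x.2.2)).bddAbove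
    exact ⟨R, fun k g i j => Nat.lt_succ_of_le (hR ⟨(⟨k, g⟩, i, j), rfl⟩)⟩
  obtain ⟨Ω, _, χ, e, S, h1S, of_mem, hχ, hinj, he⟩ := exists_finite_permHoms_of_pushout hφ R
  refine ⟨Perm Ω, inferInstance, inferInstance, χ, truncatedPathDist χ w (R + 1), hχ,
    isInvMetric_truncatedPathDist hw R.succ_pos, fun k g i j =>
      le_antisymm (WPath.single k g i j).truncatedPathDist_le ?_⟩
  rcases lt_or_ge (truncatedPathDist χ w (R + 1) (χ k g) i j) (R + 1) with hlt | hge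
  · exact ((wPath_truncatedPathDist_or_le χ w (R + 1) _ i j).resolve_right hlt.not_ge).le_of_local
      hφ hw hwA h1S of_mem hinj he hlt
  · exact (hR k g i j).le.trans hge

end Amalgam

/-- The distance between the points `x` and `y` of `G × ι` in the left invariant metric encoded by
`w`. -/
def invDist {G ι R : Type*} [Group G] (w : G → ι → ι → R) (x y : G × ι) : R :=
  w (x.1⁻¹ * y.1) x.2 y.2

theorem invDist_one_left {G ι R : Type*} [Group G] (w : G → ι → ι → R) (i : ι) (x : G × ι) :
    invDist w (1, i) x = w x.1 i x.2 := by
  simp [invDist]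

theorem invDist_smul {G ι R : Type*} [Group G] (w : G → ι → ι → R) (g : G) (x y : G × ι) :
    invDist w (g * x.1, x.2) (g * y.1, y.2) = invDist w x y := by
  simp [invDist, mul_assoc]

namespace IsInvMetricOn

section OrderedMonoid

variable {G ι R : Type*} [Group G] [AddCommMonoid R] [PartialOrder R]
  {K : Subgroup G} {I : Set ι} {w : G → ι → ι → R}

theorem mono (hw : IsInvMetricOn K I w) {K' : Subgroup G} {I' : Set ι} (hK : K' ≤ K)
    (hI : I' ⊆ I) : IsInvMetricOn K' I' w where
  eq_zero_iff g hg i hi j hj := hw.eq_zero_iff g (hK hg) i (hI hi) j (hI hj)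
  symm g hg i hi j hj := hw.symm g (hK hg) i (hI hi) j (hI hj)
  triangle g hg h hh i hi j hj k hk :=
    hw.triangle g (hK hg) h (hK hh) i (hI hi) j (hI hj) k (hI hk)

theorem congr {v : G → ι → ι → R} (hw : IsInvMetricOn K I w)
    (h : ∀ g ∈ K, ∀ i ∈ I, ∀ j ∈ I, v g i j = w g i j) : IsInvMetricOn K I v where
  eq_zero_iff g hg i hi j hj := by rw [h g hg i hi j hj, hw.eq_zero_iff g hg i hi j hj]
  symm g hg i hi j hj := by
    rw [h g hg i hi j hj, h _ (inv_mem hg) j hj i hi, hw.symm g hg i hi j hj]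
  triangle g hg f hf i hi j hj k hk := by
    rw [h _ (mul_mem hg hf) i hi k hk, h g hg i hi j hj, h f hf j hj k hk]
    exact hw.triangle g hg f hf i hi j hj k hk

theorem restrict (hw : IsInvMetricOn K I w) :
    IsInvMetric fun (g : K) (i j : I) => w g i j :=
  .mk (fun g i j => by
      rw [hw.eq_zero_iff g g.2 i i.2 j j.2, ← Subtype.ext_iff, OneMemClass.coe_eq_one])
    (fun g i j => hw.symm g g.2 i i.2 j j.2)
    fun g h i j k => hw.triangle g g.2 h h.2 i i.2 j j.2 k k.2

end OrderedMonoid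

variable {G ι : Type*} [Group G] {K : Subgroup G} {I : Set ι} {w : G → ι → ι → ℚ}

theorem nonneg (hw : IsInvMetricOn K I w) {g : G} (hg : g ∈ K) {i j : ι} (hi : i ∈ I)
    (hj : j ∈ I) : 0 ≤ w g i j := by
  have htri := hw.triangle g hg g⁻¹ (inv_mem hg) i hi j hj i hi
  rw [hw.symm g hg i hi j hj, mul_inv_cancel,
    (hw.eq_zero_iff 1 (one_mem _) i hi i hi).2 ⟨rfl, rfl⟩] at htri
  linarith

theorem pos (hw : IsInvMetricOn K I w) {g : G} (hg : g ∈ K) {i j : ι} (hi : i ∈ I) (hj : j ∈ I)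
    (h : ¬ (g = 1 ∧ i = j)) : 0 < w g i j :=
  (hw.nonneg hg hi hj).lt_of_ne fun h0 => h ((hw.eq_zero_iff g hg i hi j hj).1 h0.symm)

theorem invDist_self (hw : IsInvMetricOn K I w) {x : G × ι} (hx : x.2 ∈ I) :
    invDist w x x = 0 := by
  rw [invDist, inv_mul_cancel]
  exact (hw.eq_zero_iff 1 (one_mem _) _ hx _ hx).2 ⟨rfl, rfl⟩

theorem invDist_comm (hw : IsInvMetricOn K I w) {x y : G × ι} (hx : x.1 ∈ K ∧ x.2 ∈ I)
    (hy : y.1 ∈ K ∧ y.2 ∈ I) : invDist w x y = invDist w y x := by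
  have hsymm := hw.symm _ (mul_mem (inv_mem hx.1) hy.1) _ hx.2 _ hy.2
  rw [mul_inv_rev, inv_inv] at hsymm
  exact hsymm.symm

theorem invDist_triangle (hw : IsInvMetricOn K I w) {x y z : G × ι} (hx : x.1 ∈ K ∧ x.2 ∈ I)
    (hy : y.1 ∈ K ∧ y.2 ∈ I) (hz : z.1 ∈ K ∧ z.2 ∈ I) :
    invDist w x z ≤ invDist w x y + invDist w y z := by
  simpa [invDist, mul_assoc] using hw.triangle _ (mul_mem (inv_mem hx.1) hy.1) _
    (mul_mem (inv_mem hy.1) hz.1) _ hx.2 _ hy.2 _ hz.2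

theorem invDist_nonneg (hw : IsInvMetricOn K I w) {x y : G × ι} (hx : x.1 ∈ K ∧ x.2 ∈ I)
    (hy : y.1 ∈ K ∧ y.2 ∈ I) : 0 ≤ invDist w x y :=
  hw.nonneg (mul_mem (inv_mem hx.1) hy.1) hx.2 hy.2

end IsInvMetricOn

theorem IsInvMetric.exists_transport {H G ι κ R : Type*} [Group H] [Group G] [AddCommMonoid R]
    [PartialOrder R] {v : H → ι → ι → R} (hv : IsInvMetric v) {τ : H →* G}
    (hτ : Function.Injective τ) {σ : ι → κ} (hσ : Function.Injective σ) :
    ∃ e : G → κ → κ → R, IsInvMetricOn τ.range (Set.range σ) e ∧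
      ∀ h i j, e (τ h) (σ i) (σ j) = v h i j := by
  let e (g : G) (i j : κ) : R := Function.extend (Prod.map τ (Prod.map σ σ))
    (fun x => v x.1 x.2.1 x.2.2) (fun _ => 0) (g, i, j)
  have he (h i j) : e (τ h) (σ i) (σ j) = v h i j :=
    (hτ.prodMap (hσ.prodMap hσ)).extend_apply _ _ (h, i, j)
  refine ⟨e, ⟨?_, ?_, ?_⟩, he⟩
  · rintro _ ⟨h, rfl⟩ _ ⟨i, rfl⟩ _ ⟨j, rfl⟩
    rw [he, hv.eq_zero_iff, map_eq_one_iff τ hτ, hσ.eq_iff]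
  · rintro _ ⟨h, rfl⟩ _ ⟨i, rfl⟩ _ ⟨j, rfl⟩
    rw [← map_inv, he, he, hv.symm]
  · rintro _ ⟨h, rfl⟩ _ ⟨k, rfl⟩ _ ⟨i, rfl⟩ _ ⟨j, rfl⟩ _ ⟨l, rfl⟩
    rw [← map_mul, he, he, he]
    exact hv.triangle h k i j l

/-- The distances `f` from a new point to the points of `W ⊆ G × ι` and the distances `s` from the
new point to its translates by elements of `A` are compatible with the invariant metric `w`. -/
structure IsKatetov {G ι : Type*} [Group G] (A : Subgroup G) (s : G → ℚ) (W : Set (G × ι))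
    (w : G → ι → ι → ℚ) (f : G × ι → ℚ) : Prop where
  pos : ∀ x ∈ W, 0 < f x
  le_add : ∀ x ∈ W, ∀ y ∈ W, f x ≤ f y + invDist w y x
  dist_le : ∀ x ∈ W, ∀ y ∈ W, invDist w x y ≤ f x + f y
  smul_mem : ∀ a ∈ A, ∀ x ∈ W, (a * x.1, x.2) ∈ W
  smul_le : ∀ a ∈ A, ∀ x ∈ W, f (a * x.1, x.2) ≤ s a + f x
  norm_le : ∀ a ∈ A, ∀ x ∈ W, s a ≤ f x + f (a * x.1, x.2)
  norm_eq_zero : ∀ a ∈ A, (s a = 0 ↔ a = 1)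
  norm_inv : ∀ a ∈ A, s a⁻¹ = s a
  norm_mul : ∀ a ∈ A, ∀ b ∈ A, s (a * b) ≤ s a + s b

/-- The function `w` extended by a new index `n`, where `s` gives the distances within the new orbit
and `f` the distances from `(1, n)` to the other orbits. -/
def insertOrbit {G ι : Type*} [Group G] [DecidableEq ι] (n : ι) (s : G → ℚ) (w : G → ι → ι → ℚ)
    (f : G × ι → ℚ) (g : G) (i j : ι) : ℚ :=
  if i = n then (if j = n then s g else f (g, j)) else if j = n then f (g⁻¹, i) else w g i j

namespace IsKatetov

variable {G ι : Type*} [Group G] {A K : Subgroup G} {s : G → ℚ} {W : Set (G × ι)} {I : Set ι}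
  {w : G → ι → ι → ℚ} {f : G × ι → ℚ}

theorem congr (h : IsKatetov A s W w f) {w' : G → ι → ι → ℚ} {s' : G → ℚ} {f' : G × ι → ℚ}
    (hw : ∀ x ∈ W, ∀ y ∈ W, invDist w' x y = invDist w x y) (hs : ∀ a ∈ A, s' a = s a)
    (hf : ∀ x ∈ W, f' x = f x) : IsKatetov A s' W w' f' where
  pos x hx := by rw [hf x hx]; exact h.pos x hx
  le_add x hx y hy := by rw [hf x hx, hf y hy, hw y hy x hx]; exact h.le_add x hx y hy
  dist_le x hx y hy := by rw [hf x hx, hf y hy, hw x hx y hy]; exact h.dist_le x hx y hy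
  smul_mem := h.smul_mem
  smul_le a ha x hx := by
    rw [hf _ (h.smul_mem a ha x hx), hf x hx, hs a ha]; exact h.smul_le a ha x hx
  norm_le a ha x hx := by
    rw [hf _ (h.smul_mem a ha x hx), hf x hx, hs a ha]; exact h.norm_le a ha x hx
  norm_eq_zero a ha := by rw [hs a ha]; exact h.norm_eq_zero a ha
  norm_inv a ha := by rw [hs a ha, hs _ (inv_mem ha)]; exact h.norm_inv a ha
  norm_mul a ha b hb := by
    rw [hs a ha, hs b hb, hs _ (mul_mem ha hb)]; exact h.norm_mul a ha b hb

theorem of_isInvMetricOn {T : Set ι} (hw : IsInvMetricOn A I w) (hT : T ⊆ I) {c : ι} (hc : c ∈ I)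
    (hcT : c ∉ T) :
    IsKatetov A (fun a => w a c c) {x | x.1 ∈ A ∧ x.2 ∈ T} w (fun x => w x.1 c x.2) := by
  have mem_I {x : G × ι} (hx : x.1 ∈ A ∧ x.2 ∈ T) : x.1 ∈ A ∧ x.2 ∈ I := ⟨hx.1, hT hx.2⟩
  have smul_mem {a : G} (ha : a ∈ A) {x : G × ι} (hx : x.1 ∈ A ∧ x.2 ∈ T) :
      a * x.1 ∈ A ∧ x.2 ∈ T := ⟨mul_mem ha hx.1, hx.2⟩
  have hc₁ : (1 : G) ∈ A ∧ c ∈ I := ⟨one_mem _, hc⟩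
  have dist_smul (a : G) (x : G × ι) : invDist w (a, c) (a * x.1, x.2) = invDist w (1, c) x := by
    simpa using invDist_smul w a (1, c) x
  simp_rw [← invDist_one_left w c]
  refine ⟨fun x hx => ?_, fun x hx y hy => ?_, fun x hx y hy => ?_, fun a ha x hx => smul_mem ha hx,
    fun a ha x hx => ?_, fun a ha x hx => ?_, fun a ha => ?_, fun a ha => ?_, fun a ha b hb => ?_⟩
  · rw [invDist_one_left]
    exact hw.pos hx.1 hc (hT hx.2) fun h => hcT (h.2 ▸ hx.2)
  · exact hw.invDist_triangle hc₁ (mem_I hy) (mem_I hx)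
  · rw [hw.invDist_comm hc₁ (mem_I hx)]
    exact hw.invDist_triangle (mem_I hx) hc₁ (mem_I hy)
  · rw [← dist_smul a x, ← invDist_one_left w c (a, c)]
    exact hw.invDist_triangle hc₁ ⟨ha, hc⟩ (mem_I (smul_mem ha hx))
  · rw [← dist_smul a x, ← invDist_one_left w c (a, c), add_comm,
      hw.invDist_comm (x := (a, c)) ⟨ha, hc⟩ (mem_I (smul_mem ha hx))]
    exact hw.invDist_triangle hc₁ (mem_I (smul_mem ha hx)) ⟨ha, hc⟩
  · simpa using hw.eq_zero_iff a ha c hc c hc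
  · exact hw.symm a ha c hc c hc
  · exact hw.triangle a ha b hb c hc c hc c hc

/-- The extension is the largest one, given by shortest paths through `W`. -/
theorem exists_extend_points (h : IsKatetov A s W w f) (hfin : W.Finite) (hne : W.Nonempty)
    (hw : IsInvMetricOn K I w) (hAK : A ≤ K) (hW : ∀ x ∈ W, x.1 ∈ K ∧ x.2 ∈ I) :
    ∃ f' : G × ι → ℚ, IsKatetov A s {x | x.1 ∈ K ∧ x.2 ∈ I} w f' ∧ ∀ x ∈ W, f' x = f x := by
  choose p hpW hp using fun x =>
    Set.exists_min_image W (fun y => f y + invDist w y x) hfin hne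
  have smul_mem (a) (ha : a ∈ A) (x : G × ι) (hx : x.1 ∈ K ∧ x.2 ∈ I) : a * x.1 ∈ K ∧ x.2 ∈ I :=
    ⟨mul_mem (hAK ha) hx.1, hx.2⟩
  have extends_f (x) (hx : x ∈ W) : f (p x) + invDist w (p x) x = f x := by
    refine le_antisymm ?_ (h.le_add x hx _ (hpW x))
    simpa [hw.invDist_self (hW x hx).2] using hp x x hx
  refine ⟨fun x => f (p x) + invDist w (p x) x, ⟨fun x hx => ?_, fun x hx y hy => ?_,
    fun x hx y hy => ?_, smul_mem, fun a ha x _ => ?_, fun a ha x hx => ?_, h.norm_eq_zero,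
    h.norm_inv, h.norm_mul⟩, extends_f⟩
  · exact add_pos_of_pos_of_nonneg (h.pos _ (hpW x)) (hw.invDist_nonneg (hW _ (hpW x)) hx)
  · linarith [hp x _ (hpW y), hw.invDist_triangle (hW _ (hpW y)) hy hx]
  · linarith [hw.invDist_triangle hx (hW _ (hpW x)) hy,
      hw.invDist_triangle (hW _ (hpW x)) (hW _ (hpW y)) hy, h.dist_le _ (hpW x) _ (hpW y),
      hw.invDist_comm hx (hW _ (hpW x))]
  · have hle := hp (a * x.1, x.2) _ (h.smul_mem a ha _ (hpW x))
    rw [invDist_smul] at hle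
    linarith [h.smul_le a ha _ (hpW x)]
  · have htri := hw.invDist_triangle (hW _ (hpW (a * x.1, x.2))) (y := (a * x.1, x.2))
      (smul_mem a ha x hx) (hW _ (h.smul_mem a ha _ (hpW x)))
    rw [invDist_smul, hw.invDist_comm hx (hW _ (hpW x))] at htri
    linarith [h.norm_le a ha _ (hpW x),
      h.le_add _ (h.smul_mem a ha _ (hpW x)) _ (hpW (a * x.1, x.2))]

theorem of_extend (h : IsKatetov A s W w f) (hK : ∀ g ∈ K, ∀ x ∈ W, (g * x.1, x.2) ∈ W)
    {u : G → ℚ} (huA : ∀ g ∈ A, u g = s g)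
    (exists_eq : ∀ g, g ∉ A → ∃ x ∈ W, u g = f x + f (g⁻¹ * x.1, x.2))
    (norm_le : ∀ g ∈ K, ∀ x ∈ W, u g ≤ f x + f (g⁻¹ * x.1, x.2)) : IsKatetov K u W w f := by
  have smul_le (g) (hg : g ∈ K) (x) (hx : x ∈ W) : f (g * x.1, x.2) ≤ u g + f x := by
    by_cases hgA : g ∈ A
    · exact huA g hgA ▸ h.smul_le g hgA x hx
    · obtain ⟨y, hy, hu⟩ := exists_eq g hgA
      have hdist := h.dist_le _ (hK _ (inv_mem hg) _ hy) x hx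
      rw [← invDist_smul w g] at hdist
      simp only [mul_inv_cancel_left] at hdist
      linarith [h.le_add _ (hK g hg x hx) _ hy]
  have norm_inv_le (g) (hg : g ∈ K) : u g⁻¹ ≤ u g := by
    by_cases hgA : g ∈ A
    · rw [huA g hgA, huA _ (inv_mem hgA), h.norm_inv g hgA]
    · obtain ⟨y, hy, hu⟩ := exists_eq g hgA
      rw [hu, add_comm]
      simpa using norm_le _ (inv_mem hg) _ (hK _ (inv_mem hg) _ hy)
  have norm_inv (g) (hg : g ∈ K) : u g⁻¹ = u g :=
    le_antisymm (norm_inv_le g hg) (by simpa using norm_inv_le g⁻¹ (inv_mem hg))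
  refine { h with smul_mem := hK, smul_le, norm_inv, norm_le := fun g hg x hx => ?_,
                  norm_eq_zero := fun g hg => ?_, norm_mul := fun g hg k hk => ?_ }
  · simpa [add_comm] using norm_le g hg _ (hK g hg x hx)
  · by_cases hgA : g ∈ A
    · exact huA g hgA ▸ h.norm_eq_zero g hgA
    · obtain ⟨y, hy, hu⟩ := exists_eq g hgA
      have hpos := add_pos (h.pos _ hy) (h.pos _ (hK _ (inv_mem hg) _ hy))
      exact iff_of_false (hu ▸ hpos.ne') fun hg1 => hgA (hg1 ▸ one_mem A)
  · by_cases hgA : g ∈ A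
    · by_cases hkA : k ∈ A
      · rw [huA g hgA, huA k hkA, huA _ (mul_mem hgA hkA)]
        exact h.norm_mul g hgA k hkA
      · obtain ⟨y, hy, hu⟩ := exists_eq k hkA
        have hle := norm_le _ (mul_mem hg hk) _ (hK g hg _ hy)
        simp only [mul_inv_rev, mul_assoc, inv_mul_cancel_left] at hle
        linarith [smul_le g hg _ hy]
    · obtain ⟨y, hy, hu⟩ := exists_eq g hgA
      have hle := norm_le _ (mul_mem hg hk) _ hy
      have hsmul := smul_le _ (inv_mem hk) _ (hK _ (inv_mem hg) _ hy)
      rw [norm_inv k hk] at hsmul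
      simp only [mul_inv_rev, mul_assoc] at hle hsmul
      linarith

/-- Outside of `A` the extension is the largest one: the distance from the new point to a translate
is that of the shortest path through `K × I`. -/
theorem exists_extend_group [Finite K] (hI : I.Finite) (hne : I.Nonempty)
    (h : IsKatetov A s {x | x.1 ∈ K ∧ x.2 ∈ I} w f) :
    ∃ u : G → ℚ, IsKatetov K u {x | x.1 ∈ K ∧ x.2 ∈ I} w f ∧ ∀ a ∈ A, u a = s a := by
  classical
  choose p hpP hp using fun g : G => Set.exists_min_image {x : G × ι | x.1 ∈ K ∧ x.2 ∈ I}
    (fun y => f y + f (g⁻¹ * y.1, y.2)) ((Set.toFinite (K : Set G)).prod hI)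
    (hne.elim fun i hi => ⟨(1, i), one_mem _, hi⟩)
  let u (g : G) : ℚ := if g ∈ A then s g else f (p g) + f (g⁻¹ * (p g).1, (p g).2)
  have huA (g) (hg : g ∈ A) : u g = s g := if_pos hg
  have hu (g) (hg : g ∉ A) : u g = f (p g) + f (g⁻¹ * (p g).1, (p g).2) := if_neg hg
  refine ⟨u, h.of_extend (fun g hg x hx => ⟨mul_mem hg hx.1, hx.2⟩) huA
    (fun g hg => ⟨p g, hpP g, hu g hg⟩) (fun g hg x hx => ?_), huA⟩
  by_cases hgA : g ∈ A
  · rw [huA g hgA, add_comm]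
    simpa using h.norm_le g hgA (g⁻¹ * x.1, x.2) ⟨mul_mem (inv_mem hg) hx.1, hx.2⟩
  · exact hu g hgA ▸ hp g x hx

theorem isInvMetricOn_insertOrbit [DecidableEq ι] (h : IsKatetov K s {x | x.1 ∈ K ∧ x.2 ∈ I} w f)
    (hw : IsInvMetricOn K I w) {n : ι} (hn : n ∉ I) :
    IsInvMetricOn K (insert n I) (insertOrbit n s w f) := by
  have ne_n {i} (hi : i ∈ I) : i ≠ n := fun h => hn (h ▸ hi)
  have at_nn (g) : insertOrbit n s w f g n n = s g := by simp [insertOrbit]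
  have at_ni (g) {i} (hi : i ∈ I) : insertOrbit n s w f g n i = f (g, i) := by
    simp [insertOrbit, ne_n hi]
  have at_in (g) {i} (hi : i ∈ I) : insertOrbit n s w f g i n = f (g⁻¹, i) := by
    simp [insertOrbit, ne_n hi]
  have at_ij (g) {i j} (hi : i ∈ I) (hj : j ∈ I) : insertOrbit n s w f g i j = w g i j := by
    simp [insertOrbit, ne_n hi, ne_n hj]
  refine ⟨?_, ?_, ?_⟩
  · rintro g hg i (rfl | hi) j (rfl | hj)
    · simpa [at_nn] using h.norm_eq_zero g hg
    · exact at_ni g hj ▸ iff_of_false (h.pos (g, j) ⟨hg, hj⟩).ne' fun h0 => ne_n hj h0.2.symm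
    · exact at_in g hi ▸ iff_of_false (h.pos (g⁻¹, i) ⟨inv_mem hg, hi⟩).ne' fun h0 => ne_n hi h0.2
    · exact at_ij g hi hj ▸ hw.eq_zero_iff g hg i hi j hj
  · rintro g hg i (rfl | hi) j (rfl | hj)
    · rw [at_nn, at_nn, h.norm_inv g hg]
    · rw [at_ni g hj, at_in _ hj, inv_inv]
    · rw [at_in g hi, at_ni _ hi]
    · rw [at_ij g hi hj, at_ij _ hj hi, hw.symm g hg i hi j hj]
  · rintro g hg k hk i (rfl | hi) j (rfl | hj) l (rfl | hl)
    · simpa only [at_nn] using h.norm_mul g hg k hk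
    · simpa only [at_nn, at_ni _ hl] using h.smul_le g hg (k, l) ⟨hk, hl⟩
    · have hle := h.norm_le _ (mul_mem hg hk) (k⁻¹, j) ⟨inv_mem hk, hj⟩
      rw [at_nn, at_ni _ hj, at_in _ hj]
      simpa [add_comm] using hle
    · rw [at_ni _ hl, at_ni _ hj, at_ij _ hj hl]
      simpa [invDist] using h.le_add (g * k, l) ⟨mul_mem hg hk, hl⟩ (g, j) ⟨hg, hj⟩
    · rw [at_in _ hi, at_in _ hi, at_nn, add_comm, mul_inv_rev, ← h.norm_inv k hk]
      exact h.smul_le _ (inv_mem hk) (g⁻¹, i) ⟨inv_mem hg, hi⟩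
    · rw [at_in _ hi, at_ni _ hl, at_ij _ hi hl]
      simpa [invDist] using h.dist_le (g⁻¹, i) ⟨inv_mem hg, hi⟩ (k, l) ⟨hk, hl⟩
    · rw [at_in _ hi, at_in _ hj, at_ij _ hi hj, add_comm, ← hw.symm g hg i hi j hj]
      simpa [invDist] using
        h.le_add ((g * k)⁻¹, i) ⟨inv_mem (mul_mem hg hk), hi⟩ (k⁻¹, j) ⟨inv_mem hk, hj⟩
    · rw [at_ij _ hi hl, at_ij _ hi hj, at_ij _ hj hl]
      exact hw.triangle g hg k hk i hi j hj l hl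

theorem exists_insert [Finite K] (hI : I.Finite) (h : IsKatetov A s W w f) (hAK : A ≤ K)
    (hW : ∀ x ∈ W, x.1 ∈ K ∧ x.2 ∈ I) (hne : W.Nonempty) (hw : IsInvMetricOn K I w) {n : ι}
    (hn : n ∉ I) :
    ∃ w' : G → ι → ι → ℚ, IsInvMetricOn K (insert n I) w' ∧
      (∀ g, ∀ i ∈ I, ∀ j ∈ I, w' g i j = w g i j) ∧ (∀ a ∈ A, w' a n n = s a) ∧
      ∀ x ∈ W, w' x.1 n x.2 = f x := by
  classical
  obtain ⟨f', hf', hff'⟩ := h.exists_extend_points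
    (((Set.toFinite (K : Set G)).prod hI).subset hW) hne hw hAK hW
  obtain ⟨u, hu, huA⟩ := hf'.exists_extend_group hI (hne.elim fun x hx => ⟨x.2, (hW x hx).2⟩)
  have ne_n {i} (hi : i ∈ I) : i ≠ n := fun h => hn (h ▸ hi)
  refine ⟨insertOrbit n u w f', hu.isInvMetricOn_insertOrbit hw hn, fun g i hi j hj => ?_,
    fun a ha => ?_, fun x hx => ?_⟩
  · simp [insertOrbit, ne_n hi, ne_n hj]
  · simp [insertOrbit, huA a ha]
  · simp [insertOrbit, ne_n (hW x hx).2, hff' x hx]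

end IsKatetov

section Amalgam

universe u v x

theorem isInvMetric_iff_of_natCast_eq {G ι : Type*} [Group G] {F : G → ι → ι → ℕ}
    {w : G → ι → ι → ℚ} {M : ℕ} (hM : 0 < M) (hF : ∀ g i j, (F g i j : ℚ) = M * w g i j) :
    IsInvMetric F ↔ IsInvMetric w := by
  have hM' : (0 : ℚ) < M := mod_cast hM
  have eq_zero_iff (g i j) : F g i j = 0 ↔ w g i j = 0 := by
    rw [← Nat.cast_eq_zero (R := ℚ), hF, mul_eq_zero_iff_left hM'.ne']
  have eq_iff (g h i j) : F h j i = F g i j ↔ w h j i = w g i j := by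
    rw [← Nat.cast_inj (R := ℚ), hF, hF, mul_right_inj' hM'.ne']
  have le_add_iff (g h i j k) :
      F (g * h) i k ≤ F g i j + F h j k ↔ w (g * h) i k ≤ w g i j + w h j k := by
    rw [← Nat.cast_le (α := ℚ), Nat.cast_add, hF, hF, hF, ← mul_add, mul_le_mul_iff_right₀ hM']
  exact ⟨fun h => .mk (fun g i j => (eq_zero_iff g i j).symm.trans h.eq_zero_iff)
      (fun g i j => (eq_iff _ _ i j).1 (h.symm g i j))
      fun a b i j k => (le_add_iff a b i j k).1 (h.triangle a b i j k),
    fun h => .mk (fun g i j => (eq_zero_iff g i j).trans h.eq_zero_iff)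
      (fun g i j => (eq_iff _ _ i j).2 (h.symm g i j))
      fun a b i j k => (le_add_iff a b i j k).2 (h.triangle a b i j k)⟩

theorem exists_natCast_eq_mul {X : Type*} [Finite X] {f : X → ℚ} (hf : ∀ x, 0 ≤ f x) :
    ∃ M : ℕ, 0 < M ∧ ∃ F : X → ℕ, ∀ x, (F x : ℚ) = M * f x := by
  have := Fintype.ofFinite X
  refine ⟨∏ x, (f x).den, Finset.prod_pos fun x _ => (f x).den_pos, ?_⟩
  choose c hc using fun x => Finset.dvd_prod_of_mem (fun x => (f x).den) (Finset.mem_univ x)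
  refine ⟨fun x => c x * (f x).num.toNat, fun x => ?_⟩
  have cast_num : ((f x).num.toNat : ℚ) = (f x).num :=
    mod_cast Int.toNat_of_nonneg (Rat.num_nonneg.2 (hf x))
  rw [hc x, Nat.cast_mul, Nat.cast_mul, cast_num, ← Rat.den_mul_eq_num]
  ring

theorem exists_amalgam_rat {κ : Type u} {A : Type x} {ι : Type*} {L : κ → Type v}
    [∀ k, Group (L k)] [Group A] [Finite κ] [∀ k, Finite (L k)] [Finite A] [Finite ι]
    {φ : ∀ k, A →* L k} (hφ : ∀ k, Function.Injective (φ k)) {w : ∀ k, L k → ι → ι → ℚ}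
    (hw : ∀ k, IsInvMetric (w k)) (hwA : ∀ k l a i j, w k (φ k a) i j = w l (φ l a) i j) :
    ∃ (D : Type (max u v x)) (_ : Group D) (_ : Finite D) (χ : ∀ k, L k →* D) (v : D → ι → ι → ℚ),
      (∀ k l a, χ k (φ k a) = χ l (φ l a)) ∧ IsInvMetric v ∧
      ∀ k g i j, v (χ k g) i j = w k g i j := by
  obtain ⟨M, hM, F, hF⟩ := exists_natCast_eq_mul
    (f := fun x : (Σ k, L k) × ι × ι => w x.1.1 x.1.2 x.2.1 x.2.2)
    fun x => (hw x.1.1).nonneg trivial trivial trivial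
  have hM' : (M : ℚ) ≠ 0 := mod_cast hM.ne'
  have hFw (k) (g : L k) (i j) : (F (⟨k, g⟩, i, j) : ℚ) = M * w k g i j := hF (⟨k, g⟩, i, j)
  obtain ⟨D, _, _, χ, v, hχ, hv, hvF⟩ := exists_amalgam_nat hφ
    (fun k => (isInvMetric_iff_of_natCast_eq hM (hFw k)).2 (hw k)) fun k l a i j => by
      rw [← Nat.cast_inj (R := ℚ), hFw, hFw, hwA k l]
  refine ⟨D, ‹_›, ‹_›, χ, fun g i j => v g i j / M, hχ,
    (isInvMetric_iff_of_natCast_eq hM fun g i j => (mul_div_cancel₀ _ hM').symm).1 hv,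
    fun k g i j => ?_⟩
  change (v (χ k g) i j : ℚ) / M = _
  rw [hvF, hFw, mul_div_cancel_left₀ _ hM']

end Amalgam

theorem IsHallGroup.exists_extension {G A B : Type*} [Group G] [Group A] [Group B] [Finite A]
    [Finite B] (hG : IsHallGroup G) {ι : A →* B} {ρ : A →* G} (hι : Function.Injective ι)
    (hρ : Function.Injective ρ) : ∃ σ : B →* G, Function.Injective σ ∧ ∀ a, σ (ι a) = ρ a := by
  let eA : Shrink.{0} A ≃* A := Shrink.mulEquiv
  let eB : Shrink.{0} B ≃* B := Shrink.mulEquiv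
  have hfinA : Finite (Shrink.{0} A) := .of_equiv A eA.symm
  have hfinB : Finite (Shrink.{0} B) := .of_equiv B eB.symm
  obtain ⟨σ, hσ, hσι⟩ := hG.extension (Shrink.{0} A) (Shrink.{0} B)
    ((eB.symm.toMonoidHom.comp ι).comp eA.toMonoidHom) (ρ.comp eA.toMonoidHom)
    ((eB.symm.injective.comp hι).comp eA.injective) (hρ.comp eA.injective)
  exact ⟨σ.comp eB.symm.toMonoidHom, hσ.comp eB.symm.injective, fun a => by
    simpa using DFunLike.congr_fun hσι (eA.symm a)⟩

section

variable {G ι : Type*} [Group G] {A B K : Subgroup G}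

theorem IsHallGroup.exists_amalgam (hG : IsHallGroup G) [Finite K] [Finite B] (hK : A ≤ K)
    (hB : A ≤ B) {I : Set ι} (hI : I.Finite) (hne : I.Nonempty) {w e : G → ι → ι → ℚ}
    (hw : IsInvMetricOn K I w) (he : IsInvMetricOn B I e)
    (hwe : ∀ a ∈ A, ∀ i ∈ I, ∀ j ∈ I, w a i j = e a i j) :
    ∃ (τ : B →* G) (K' : Subgroup G) (w' : G → ι → ι → ℚ), Finite K' ∧ K ≤ K' ∧
      IsInvMetricOn K' I w' ∧ (∀ g ∈ K, ∀ i ∈ I, ∀ j ∈ I, w' g i j = w g i j) ∧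
      (∀ b : B, τ b ∈ K') ∧ (∀ b : B, (b : G) ∈ A → τ b = b) ∧
      ∀ b : B, ∀ i ∈ I, ∀ j ∈ I, w' (τ b) i j = e b i j := by
  have : Finite I := hI.to_subtype
  have : Finite A := .of_injective _ (Subgroup.inclusion_injective hK)
  let L (b : Bool) : Subgroup G := bif b then K else B
  let W (b : Bool) : G → ι → ι → ℚ := bif b then w else e
  have hL (b) : A ≤ L b := by cases b <;> assumption
  have hfin (b) : Finite (L b) := by cases b <;> assumption
  have hW (b) : IsInvMetricOn (L b) I (W b) := by cases b <;> assumption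
  obtain ⟨D, _, _, χ, v, hχ, hv, hvW⟩ := exists_amalgam_rat
    (fun b => Subgroup.inclusion_injective (hL b)) (fun b => (hW b).restrict)
    fun k l a i j => by
      have := hwe a a.2 i i.2 j j.2
      cases k <;> cases l <;> simp [W, this]
  obtain ⟨i₀, hi₀⟩ := hne
  have χ_injective : Function.Injective (χ true) := (injective_iff_map_eq_one _).2 fun g hg => by
    have hg0 := hvW true g ⟨i₀, hi₀⟩ ⟨i₀, hi₀⟩
    rw [hg, hv.eq_zero_iff.2 ⟨rfl, rfl⟩] at hg0
    exact ((hW true).restrict.eq_zero_iff.1 hg0.symm).1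
  obtain ⟨σ, hσ, hσχ⟩ := hG.exists_extension χ_injective (L true).subtype_injective
  obtain ⟨w', hw', hw'v⟩ := hv.exists_transport hσ (Subtype.val_injective (p := (· ∈ I)))
  rw [Subtype.range_coe] at hw'
  refine ⟨σ.comp (χ false), σ.range, w', Set.finite_range σ, fun g hg => ⟨χ true ⟨g, hg⟩, hσχ _⟩,
    hw', fun g hg i hi j hj => ?_, fun b => ⟨_, rfl⟩, fun b hb => ?_, fun b i hi j hj => ?_⟩
  · have heq := hw'v (χ true ⟨g, hg⟩) ⟨i, hi⟩ ⟨j, hj⟩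
    rwa [hσχ, hvW true] at heq
  · exact (congrArg σ (hχ false true ⟨b, hb⟩)).trans (hσχ _)
  · exact (hw'v (χ false b) ⟨i, hi⟩ ⟨j, hj⟩).trans (hvW false b _ _)

namespace IsInvMetricOn

theorem exists_extend_insert [Finite B] (hAB : A ≤ B) {I S : Set ι} (hS : S.Finite)
    (hne : S.Nonempty) (hSI : S ⊆ I) {w e : G → ι → ι → ℚ} (hw : IsInvMetricOn A I w)
    (he : IsInvMetricOn B S e) (hwe : ∀ a ∈ A, ∀ i ∈ S, ∀ j ∈ S, e a i j = w a i j) {c : ι}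
    (hcI : c ∈ I) (hcS : c ∉ S) :
    ∃ e' : G → ι → ι → ℚ, IsInvMetricOn B (insert c S) e' ∧
      (∀ g, ∀ i ∈ S, ∀ j ∈ S, e' g i j = e g i j) ∧
      ∀ a ∈ A, ∀ i ∈ insert c S, ∀ j ∈ insert c S, e' a i j = w a i j := by
  have hkat := (IsKatetov.of_isInvMetricOn hw hSI hcI hcS).congr (w' := e)
    (fun x hx y hy => hwe _ (mul_mem (inv_mem hx.1) hy.1) _ hx.2 _ hy.2) (fun _ _ => rfl)
    fun _ _ => rfl
  obtain ⟨e', he', he'e, he's, he'f⟩ := hkat.exists_insert hS hAB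
    (fun x hx => ⟨hAB hx.1, hx.2⟩) (hne.elim fun t ht => ⟨(1, t), one_mem _, ht⟩) he hcS
  have he'c (a) (ha : a ∈ A) (j) (hj : j ∈ S) : e' a c j = w a c j := he'f (a, j) ⟨ha, hj⟩
  refine ⟨e', he', he'e, ?_⟩
  rintro a ha i (rfl | hi) j (rfl | hj)
  · exact he's a ha
  · exact he'c a ha j hj
  · rw [← he'.symm _ (hAB ha) _ (Or.inr hi) _ (Or.inl rfl), he'c _ (inv_mem ha) i hi,
      hw.symm a ha _ (hSI hi) _ hcI]
  · rw [he'e a i hi j hj, hwe a ha i hi j hj]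

theorem exists_extend_index [Finite B] (hAB : A ≤ B) {I T : Set ι} (hI : I.Finite)
    (hT : T.Nonempty) (hTI : T ⊆ I) {w e : G → ι → ι → ℚ} (hw : IsInvMetricOn A I w)
    (he : IsInvMetricOn B T e) (hwe : ∀ a ∈ A, ∀ i ∈ T, ∀ j ∈ T, e a i j = w a i j) :
    ∃ e' : G → ι → ι → ℚ, IsInvMetricOn B I e' ∧ (∀ g, ∀ i ∈ T, ∀ j ∈ T, e' g i j = e g i j) ∧
      ∀ a ∈ A, ∀ i ∈ I, ∀ j ∈ I, e' a i j = w a i j := by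
  suffices ∀ S : Set ι, S.Finite → S ⊆ I → ∃ e' : G → ι → ι → ℚ, IsInvMetricOn B (S ∪ T) e' ∧
      (∀ g, ∀ i ∈ T, ∀ j ∈ T, e' g i j = e g i j) ∧
      ∀ a ∈ A, ∀ i ∈ S ∪ T, ∀ j ∈ S ∪ T, e' a i j = w a i j by
    simpa only [Set.union_eq_self_of_subset_right hTI] using this I hI le_rfl
  intro S hS
  induction S, hS using Set.Finite.induction_on with
  | empty => exact fun _ => ⟨e, by simpa using he, fun _ _ _ _ _ => rfl, by simpa using hwe⟩
  | @insert c S _ _ ih =>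
    intro hcSI
    obtain ⟨e', he', he'e, he'w⟩ := ih ((Set.subset_insert c S).trans hcSI)
    rw [Set.insert_union]
    by_cases hcT : c ∈ S ∪ T
    · exact ⟨e', (Set.insert_eq_of_mem hcT).symm ▸ he', he'e, by rwa [Set.insert_eq_of_mem hcT]⟩
    have hSTI : S ∪ T ⊆ I := Set.union_subset ((Set.subset_insert c S).trans hcSI) hTI
    obtain ⟨e'', he'', he''e', he''w⟩ := exists_extend_insert hAB (hI.subset hSTI)
      (hT.mono Set.subset_union_right) hSTI hw he' he'w (hcSI (Set.mem_insert c S)) hcT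
    exact ⟨e'', he'', fun g i hi j hj =>
      (he''e' g i (Or.inr hi) j (Or.inr hj)).trans (he'e g i hi j hj), he''w⟩

end IsInvMetricOn

end

open Classical in
theorem IsInvMetricOn.extend_const {G ι : Type*} [Group G] {K : Subgroup G} {I : Set ι}
    {w : G → ι → ι → ℚ} (hw : IsInvMetricOn K I w) {R : ℚ} (hR : 0 < R)
    (hle : ∀ g ∈ K, ∀ i ∈ I, ∀ j ∈ I, w g i j ≤ R) :
    IsInvMetricOn ⊤ I fun g i j => if g ∈ K then w g i j else R := by
  refine ⟨fun g _ i hi j hj => ?_, fun g _ i hi j hj => ?_, fun g _ f _ i hi j hj l hl => ?_⟩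
  · split_ifs with hg
    · exact hw.eq_zero_iff g hg i hi j hj
    · exact iff_of_false hR.ne' fun h => hg (h.1 ▸ one_mem K)
  · simp only [inv_mem_iff]
    split_ifs with hg
    · exact hw.symm g hg i hi j hj
    · rfl
  · have nonneg (h) {i j} (hi : i ∈ I) (hj : j ∈ I) : 0 ≤ if h ∈ K then w h i j else R := by
      split_ifs with hh
      exacts [hw.nonneg hh hi hj, hR.le]
    by_cases hg : g ∈ K <;> by_cases hf : f ∈ K
    · simpa only [hg, hf, mul_mem hg hf, if_true] using hw.triangle g hg f hf i hi j hj l hl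
    · simpa [hg, hf, mul_mem_cancel_left hg] using hw.nonneg hg hi hj
    · simpa [hg, hf, mul_mem_cancel_right hf] using hw.nonneg hf hj hl
    · simp only [hg, if_false]
      refine le_trans ?_ (le_add_of_nonneg_right (nonneg f hj hl))
      split_ifs with hgf
      exacts [hle _ hgf i hi l hl, le_rfl]

theorem IsKatetov.const {G ι : Type*} [Group G] {K : Subgroup G} {I : Set ι} {w : G → ι → ι → ℚ}
    (hw : IsInvMetricOn K I w) {R : ℚ} (hR : 0 < R)
    (hle : ∀ g ∈ K, ∀ i ∈ I, ∀ j ∈ I, w g i j ≤ R) :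
    IsKatetov (⊥ : Subgroup G) 0 {x | x.1 ∈ K ∧ x.2 ∈ I} w fun _ => R where
  pos _ _ := hR
  le_add x hx y hy := by linarith [hw.invDist_nonneg hy hx]
  dist_le x hx y hy :=
    (hle _ (mul_mem (inv_mem hx.1) hy.1) _ hx.2 _ hy.2).trans (le_add_of_nonneg_left hR.le)
  smul_mem a ha x hx := by simpa [Subgroup.mem_bot.1 ha] using hx
  smul_le := by simp
  norm_le _ _ _ _ := add_nonneg hR.le hR.le
  norm_eq_zero := by simp
  norm_inv := by simp
  norm_mul := by simp

/-- An invariant rational metric on `K × {0, …, k - 1}`, where `K` is a finite subgroup of `G`. -/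
structure FinInvMetric (G : Type*) [Group G] where
  /-- the finite subgroup -/
  K : Subgroup G
  /-- the number of orbits -/
  k : ℕ
  /-- the metric -/
  w : G → ℕ → ℕ → ℚ
  finite : Finite K
  pos : 0 < k
  isInvMetricOn : IsInvMetricOn K (Set.Iio k) w

namespace FinInvMetric

variable {G : Type*} [Group G]

/-- The function `w` on `G × ℕ` extends the metric `p`. -/
def Extends (p : FinInvMetric G) (w : G → ℕ → ℕ → ℚ) : Prop :=
  ∀ g ∈ p.K, ∀ i < p.k, ∀ j < p.k, w g i j = p.w g i j

instance : Preorder (FinInvMetric G) where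
  le p q := p.K ≤ q.K ∧ p.k ≤ q.k ∧ p.Extends q.w
  le_refl p := ⟨le_rfl, le_rfl, fun _ _ _ _ _ _ => rfl⟩
  le_trans p q r hpq hqr := ⟨hpq.1.trans hqr.1, hpq.2.1.trans hqr.2.1, fun g hg i hi j hj =>
    (hqr.2.2 g (hpq.1 hg) i (hi.trans_le hpq.2.1) j (hj.trans_le hpq.2.1)).trans
      (hpq.2.2 g hg i hi j hj)⟩

instance : Nonempty (FinInvMetric G) :=
  ⟨⟨⊥, 1, 0, inferInstance, one_pos, by
    refine ⟨fun g hg i hi j hj => ?_, by simp, by simp⟩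
    simp only [Subgroup.mem_bot, Set.mem_Iio, Nat.lt_one_iff] at hg hi hj
    simp [hg, hi, hj]⟩⟩

theorem exists_bound (p : FinInvMetric G) :
    ∃ R : ℚ, 0 < R ∧ ∀ g ∈ p.K, ∀ i < p.k, ∀ j < p.k, p.w g i j ≤ R := by
  have := p.finite
  obtain ⟨R, hR⟩ := (((Set.toFinite (p.K : Set G)).prod ((Set.finite_Iio p.k).prod
    (Set.finite_Iio p.k))).image fun x => p.w x.1 x.2.1 x.2.2).bddAbove
  exact ⟨max R 1, lt_max_of_lt_right one_pos, fun g hg i hi j hj =>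
    le_max_of_le_left (hR ⟨(g, i, j), ⟨hg, hi, hj⟩, rfl⟩)⟩

theorem exists_le_group (p : FinInvMetric G) (K : Subgroup G) [Finite K] (h : p.K ≤ K) :
    ∃ q, p ≤ q ∧ q.K = K := by
  classical
  obtain ⟨R, hR, hle⟩ := p.exists_bound
  exact ⟨⟨K, p.k, _, ‹_›, p.pos, (p.isInvMetricOn.extend_const hR hle).mono le_top subset_rfl⟩,
    ⟨h, le_rfl, fun g hg i _ j _ => if_pos hg⟩, rfl⟩

theorem exists_insert (p : FinInvMetric G) {A : Subgroup G} {s : G → ℚ} {W : Set (G × ℕ)}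
    {f : G × ℕ → ℚ} (h : IsKatetov A s W p.w f) (hA : A ≤ p.K)
    (hW : ∀ x ∈ W, x.1 ∈ p.K ∧ x.2 < p.k) (hne : W.Nonempty) :
    ∃ q, p ≤ q ∧ p.k < q.k ∧ (∀ a ∈ A, q.w a p.k p.k = s a) ∧
      ∀ x ∈ W, q.w x.1 p.k x.2 = f x := by
  have := p.finite
  obtain ⟨w, hw, hwp, hws, hwf⟩ := h.exists_insert (Set.finite_Iio p.k) hA hW hne p.isInvMetricOn
    (lt_irrefl p.k)
  refine ⟨⟨p.K, p.k + 1, w, p.finite, p.k.succ_pos, hw.mono le_rfl fun i hi => ?_⟩,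
    ⟨le_rfl, p.k.le_succ, fun g _ i hi j hj => hwp g i hi j hj⟩, p.k.lt_succ_self, hws, hwf⟩
  exact (Nat.lt_succ_iff_lt_or_eq.1 hi).symm

theorem exists_lt_k (p : FinInvMetric G) (n : ℕ) : ∃ q, p ≤ q ∧ n < q.k := by
  induction n with
  | zero => exact ⟨p, le_rfl, p.pos⟩
  | succ n ih =>
    obtain ⟨q, hpq, hq⟩ := ih
    obtain ⟨R, hR, hle⟩ := q.exists_bound
    obtain ⟨r, hqr, hr, -⟩ := q.exists_insert (IsKatetov.const q.isInvMetricOn hR hle) bot_le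
      (fun x hx => hx) ⟨(1, 0), one_mem _, q.pos⟩
    exact ⟨r, hpq.trans hqr, by omega⟩

theorem exists_le_of_fg (hG : IsLocallyFiniteGroup G) (p : FinInvMetric G) {A : Subgroup G}
    (hA : A.FG) (n : ℕ) : ∃ q, p ≤ q ∧ A ≤ q.K ∧ n < q.k := by
  have := p.finite
  have : Finite (p.K ⊔ A : Subgroup G) :=
    hG _ ((Group.fg_iff_subgroup_fg _).1 inferInstance |>.sup hA)
  obtain ⟨q, hpq, hq⟩ := p.exists_le_group (p.K ⊔ A) le_sup_left
  obtain ⟨r, hqr, hr⟩ := q.exists_lt_k n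
  exact ⟨r, hpq.trans hqr, (le_sup_right.trans hq.ge).trans hqr.1, hr⟩

/-- The metrics which are defined at the point `x`. -/
def coveringSet (x : G × ℕ) : Set (FinInvMetric G) := {p | x.1 ∈ p.K ∧ x.2 < p.k}

/-- The metrics which have an orbit with the distances prescribed by `s` and `f`, or are defined at
all points of `W` and incompatible with these distances. -/
def orbitSet (A : Subgroup G) (s : G → ℚ) (W : Finset (G × ℕ)) (f : G × ℕ → ℚ) :
    Set (FinInvMetric G) :=
  {p | A ≤ p.K ∧ (∀ y ∈ W, y.1 ∈ p.K ∧ y.2 < p.k) ∧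
    (W.Nonempty → IsKatetov A s W p.w f →
      ∃ n < p.k, (∀ a ∈ A, p.w a n n = s a) ∧ ∀ y ∈ W, p.w y.1 n y.2 = f y)}

/-- The metrics whose group contains a copy of `B` over `A` on which the distances between the
orbits in `I` are given by `e`, or which are defined on `A × I` and differ from `e` there. -/
def groupSet (A B : Subgroup G) (I : Finset ℕ) (e : G → ℕ → ℕ → ℚ) : Set (FinInvMetric G) :=
  {p | A ≤ p.K ∧ (∀ i ∈ I, i < p.k) ∧
    (I.Nonempty → A ≤ B → IsInvMetricOn B I e →
      (∀ a ∈ A, ∀ i ∈ I, ∀ j ∈ I, p.w a i j = e a i j) →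
      ∃ τ : B →* G, (∀ b : B, (b : G) ∈ A → τ b = b) ∧
        ∀ b : B, τ b ∈ p.K ∧ ∀ i ∈ I, ∀ j ∈ I, p.w (τ b) i j = e b i j)}

theorem isCofinal_coveringSet (hG : IsLocallyFiniteGroup G) (x : G × ℕ) :
    IsCofinal (coveringSet x) := fun p => by
  obtain ⟨q, hpq, hq, hk⟩ := p.exists_le_of_fg hG (A := Subgroup.closure {x.1})
    ⟨{x.1}, by simp⟩ x.2
  exact ⟨q, ⟨hq (Subgroup.subset_closure rfl), hk⟩, hpq⟩

theorem isCofinal_orbitSet (hG : IsLocallyFiniteGroup G) {A : Subgroup G} (hA : A.FG) (s : G → ℚ)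
    (W : Finset (G × ℕ)) (f : G × ℕ → ℚ) : IsCofinal (orbitSet A s W f) := fun p => by
  classical
  have hW_fg : (Subgroup.closure (Prod.fst '' (W : Set (G × ℕ)))).FG :=
    ⟨W.image Prod.fst, by rw [Finset.coe_image]⟩
  obtain ⟨q, hpq, hq, hk⟩ := p.exists_le_of_fg hG (hA.sup hW_fg) (W.sup Prod.snd)
  have hAq : A ≤ q.K := le_sup_left.trans hq
  have hWq (y) (hy : y ∈ W) : y.1 ∈ q.K ∧ y.2 < q.k :=
    ⟨hq (le_sup_right (a := A) (Subgroup.subset_closure ⟨y, hy, rfl⟩)),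
      (Finset.le_sup (f := Prod.snd) hy).trans_lt hk⟩
  by_cases h : W.Nonempty ∧ IsKatetov A s W q.w f
  · obtain ⟨r, hqr, hk', hs, hf⟩ := q.exists_insert h.2 hAq hWq h.1
    exact ⟨r, ⟨hAq.trans hqr.1, fun y hy => ⟨hqr.1 (hWq y hy).1, (hWq y hy).2.trans_le hqr.2.1⟩,
      fun _ _ => ⟨q.k, hk', hs, hf⟩⟩, hpq.trans hqr⟩
  · exact ⟨q, ⟨hAq, hWq, fun hne hkat => absurd ⟨hne, hkat⟩ h⟩, hpq⟩

theorem isCofinal_groupSet (hG : IsHallGroup G) {A B : Subgroup G} (hA : A.FG) (hB : B.FG)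
    (I : Finset ℕ) (e : G → ℕ → ℕ → ℚ) : IsCofinal (groupSet A B I e) := fun p => by
  classical
  obtain ⟨q, hpq, hAq, hk⟩ := p.exists_le_of_fg hG.locallyFinite hA (I.sup id)
  have hI (i) (hi : i ∈ I) : i < q.k := (Finset.le_sup (f := id) hi).trans_lt hk
  by_cases h : I.Nonempty ∧ A ≤ B ∧ IsInvMetricOn B I e ∧
      ∀ a ∈ A, ∀ i ∈ I, ∀ j ∈ I, q.w a i j = e a i j
  · obtain ⟨hne, hAB, he, hqe⟩ := h
    have := q.finite
    have : Finite B := hG.locallyFinite _ hB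
    obtain ⟨e', he', he'e, he'q⟩ := IsInvMetricOn.exists_extend_index hAB (Set.finite_Iio q.k)
      (Finset.coe_nonempty.2 hne) hI (q.isInvMetricOn.mono hAq le_rfl) he
      (fun a ha i hi j hj => (hqe a ha i hi j hj).symm)
    obtain ⟨τ, K, w, hK_fin, hqK, hw, hwq, hτK, hτA, hwe'⟩ := hG.exists_amalgam hAq hAB
      (Set.finite_Iio q.k) ⟨0, q.pos⟩ q.isInvMetricOn he'
      (fun a ha i hi j hj => (he'q a ha i hi j hj).symm)
    refine ⟨⟨K, q.k, w, hK_fin, q.pos, hw⟩, ⟨hAq.trans hqK, hI, fun _ _ _ _ => ⟨τ, hτA, fun b =>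
      ⟨hτK b, fun i hi j hj => ?_⟩⟩⟩, hpq.trans ⟨hqK, le_rfl, hwq⟩⟩
    exact (hwe' b i (hI i hi) j (hI j hj)).trans (he'e b i hi j hj)
  · exact ⟨q, ⟨hAq, hI, fun hne hAB he hqe => absurd ⟨hne, hAB, he, hqe⟩ h⟩, hpq⟩

theorem exists_limit {𝓘 : Order.Ideal (FinInvMetric G)}
    (hcov : ∀ x, ∃ p ∈ coveringSet x, p ∈ 𝓘) :
    ∃ w : G → ℕ → ℕ → ℚ, IsInvMetric w ∧ ∀ p ∈ 𝓘, p.Extends w := by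
  have hcov' (x : G × ℕ × ℕ) : ∃ p ∈ 𝓘, x.1 ∈ p.K ∧ x.2.1 < p.k ∧ x.2.2 < p.k := by
    obtain ⟨p, hp, hp𝓘⟩ := hcov (x.1, max x.2.1 x.2.2)
    exact ⟨p, hp𝓘, hp.1, (le_max_left _ _).trans_lt hp.2, (le_max_right _ _).trans_lt hp.2⟩
  choose P hP𝓘 hPK hPi hPj using hcov'
  let w (g : G) (i j : ℕ) : ℚ := (P (g, i, j)).w g i j
  have extends_w (p) (hp : p ∈ 𝓘) : p.Extends w := fun g hg i hi j hj => by
    obtain ⟨q, -, hpq, hPq⟩ := 𝓘.directed p hp _ (hP𝓘 (g, i, j))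
    rw [← hpq.2.2 g hg i hi j hj]
    exact (hPq.2.2 g (hPK _) i (hPi (g, i, j)) j (hPj (g, i, j))).symm
  have isInvMetricOn_w (p) (hp : p ∈ 𝓘) : IsInvMetricOn p.K (Set.Iio p.k) w :=
    p.isInvMetricOn.congr (extends_w p hp)
  refine ⟨w, .mk (fun g i j => ?_) (fun g i j => ?_) (fun g h i j k => ?_), extends_w⟩
  · exact (isInvMetricOn_w _ (hP𝓘 (g, i, j))).eq_zero_iff g (hPK _) i (hPi (g, i, j)) j
      (hPj (g, i, j))
  · exact (isInvMetricOn_w _ (hP𝓘 (g, i, j))).symm g (hPK _) i (hPi (g, i, j)) j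
      (hPj (g, i, j))
  · obtain ⟨q, hq, hgq, hhq⟩ := 𝓘.directed _ (hP𝓘 (g, i, j)) _ (hP𝓘 (h, j, k))
    exact (isInvMetricOn_w q hq).triangle g (hgq.1 (hPK _)) h (hhq.1 (hPK _))
      i ((hPi (g, i, j)).trans_le hgq.2.1) j ((hPj (g, i, j)).trans_le hgq.2.1)
      k ((hPj (h, j, k)).trans_le hhq.2.1)

end FinInvMetric

/-- An invariant rational metric on `G × ℕ` is generic if it has the extension properties of a
Fraïssé limit with respect to adding orbits and enlarging finite subgroups. -/
structure IsGenericInvMetric {G : Type*} [Group G] (w : G → ℕ → ℕ → ℚ) : Prop where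
  isInvMetric : IsInvMetric w
  exists_orbit : ∀ (A : Subgroup G) [Finite A] (s : G → ℚ) (W : Set (G × ℕ)) (f : G × ℕ → ℚ),
    W.Finite → W.Nonempty → IsKatetov A s W w f →
      ∃ n, (∀ a ∈ A, w a n n = s a) ∧ ∀ x ∈ W, w x.1 n x.2 = f x
  exists_hom : ∀ (A B : Subgroup G) [Finite B] (I : Set ℕ) (e : G → ℕ → ℕ → ℚ),
    A ≤ B → I.Finite → I.Nonempty → IsInvMetricOn B I e →
      (∀ a ∈ A, ∀ i ∈ I, ∀ j ∈ I, w a i j = e a i j) →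
      ∃ τ : B →* G, (∀ b : B, (b : G) ∈ A → τ b = b) ∧
        ∀ b : B, ∀ i ∈ I, ∀ j ∈ I, w (τ b) i j = e b i j

theorem exists_finsupp_eqOn {X M : Type*} [Zero M] {S : Set X} (hS : S.Finite) (f : X → M) :
    ∃ F : X →₀ M, Set.EqOn F f S := by
  classical
  refine ⟨Finsupp.onFinset hS.toFinset (S.indicator f) fun x hx => ?_, fun x hx => by simp [hx]⟩
  exact hS.mem_toFinset.2 (Set.mem_of_indicator_ne_zero hx)

theorem countable_setOf_subgroup_fg (G : Type*) [Group G] [Countable G] :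
    {A : Subgroup G | A.FG}.Countable :=
  (Set.countable_range fun S : Finset G => Subgroup.closure (S : Set G)).mono
    fun _ hA => hA

namespace IsHallGroup

variable {G : Type*} [Group G]

open FinInvMetric

theorem exists_generic_ideal (hG : IsHallGroup G) :
    ∃ 𝓘 : Order.Ideal (FinInvMetric G), (∀ x, ∃ p ∈ coveringSet x, p ∈ 𝓘) ∧
      (∀ (A : Subgroup G) (s : G →₀ ℚ) (W : Finset (G × ℕ)) (f : G × ℕ →₀ ℚ), A.FG →
        ∃ p ∈ orbitSet A s W f, p ∈ 𝓘) ∧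
      ∀ (A B : Subgroup G) (I : Finset ℕ) (e : G × ℕ × ℕ →₀ ℚ), A.FG → B.FG →
        ∃ p ∈ groupSet A B I (fun g i j => e (g, i, j)), p ∈ 𝓘 := by
  have := hG.countable
  have := (countable_setOf_subgroup_fg G).to_subtype
  let FGSubgroup := {A : Subgroup G | A.FG}
  let OrbitData := FGSubgroup × (G →₀ ℚ) × Finset (G × ℕ) × (G × ℕ →₀ ℚ)
  let GroupData := FGSubgroup × FGSubgroup × Finset ℕ × (G × ℕ × ℕ →₀ ℚ)
  let 𝒟 (t : (G × ℕ) ⊕ OrbitData ⊕ GroupData) : Order.Cofinal (FinInvMetric G) := match t with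
    | .inl x => ⟨_, isCofinal_coveringSet hG.locallyFinite x⟩
    | .inr (.inl (A, s, W, f)) => ⟨_, isCofinal_orbitSet hG.locallyFinite A.2 s W f⟩
    | .inr (.inr (A, B, I, e)) => ⟨_, isCofinal_groupSet hG A.2 B.2 I fun g i j => e (g, i, j)⟩
  have : Encodable ((G × ℕ) ⊕ OrbitData ⊕ GroupData) := Encodable.ofCountable _
  have meets (t) := Order.cofinal_meets_idealOfCofinals (Classical.arbitrary _) 𝒟 t
  exact ⟨_, fun x => meets (.inl x), fun A s W f hA => meets (.inr (.inl (⟨A, hA⟩, s, W, f))),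
    fun A B I e hA hB => meets (.inr (.inr (⟨A, hA⟩, ⟨B, hB⟩, I, e)))⟩

theorem exists_isGenericInvMetric (hG : IsHallGroup G) :
    ∃ w : G → ℕ → ℕ → ℚ, IsGenericInvMetric w := by
  obtain ⟨𝓘, hcov, horbit, hgroup⟩ := hG.exists_generic_ideal
  obtain ⟨w, hw, extends_w⟩ := exists_limit hcov
  refine ⟨w, hw, fun A _ s W f hW hne hkat => ?_, fun A B _ I e hAB hI hne he hwe => ?_⟩
  · obtain ⟨s', hs'⟩ := exists_finsupp_eqOn (Set.toFinite (A : Set G)) s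
    obtain ⟨f', hf'⟩ := exists_finsupp_eqOn hW f
    lift W to Finset (G × ℕ) using hW
    obtain ⟨p, ⟨hAp, hWp, hp⟩, hp𝓘⟩ := horbit A s' W f'
      ((Group.fg_iff_subgroup_fg A).1 inferInstance)
    have hwp := extends_w p hp𝓘
    obtain ⟨n, hn, hps, hpf⟩ := hp hne (hkat.congr (fun x hx y hy => (hwp _ (mul_mem
      (inv_mem (hWp x hx).1) (hWp y hy).1) _ (hWp x hx).2 _ (hWp y hy).2).symm) hs' hf')
    refine ⟨n, fun a ha => ?_, fun x hx => ?_⟩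
    · rw [hwp a (hAp ha) n hn n hn, hps a ha, hs' ha]
    · rw [hwp _ (hWp x hx).1 n hn _ (hWp x hx).2, hpf x hx, hf' hx]
  · have : Finite A := .of_injective _ (Subgroup.inclusion_injective hAB)
    obtain ⟨e', he'⟩ := exists_finsupp_eqOn ((Set.toFinite (B : Set G)).prod (hI.prod hI))
      fun x => e x.1 x.2.1 x.2.2
    have he'e (g) (hg : g ∈ B) (i) (hi : i ∈ I) (j) (hj : j ∈ I) : e' (g, i, j) = e g i j :=
      he' (show (g, i, j) ∈ _ from ⟨hg, hi, hj⟩)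
    lift I to Finset ℕ using hI
    obtain ⟨p, ⟨hAp, hIp, hp⟩, hp𝓘⟩ := hgroup A B I e'
      ((Group.fg_iff_subgroup_fg A).1 inferInstance) ((Group.fg_iff_subgroup_fg B).1 inferInstance)
    have hwp := extends_w p hp𝓘
    obtain ⟨τ, hτA, hτ⟩ := hp hne hAB (he.congr he'e) fun a ha i hi j hj =>
      (hwp a (hAp ha) i (hIp i hi) j (hIp j hj)).symm.trans <|
        (hwe a ha i hi j hj).trans (he'e a (hAB ha) i hi j hj).symm
    exact ⟨τ, hτA, fun b i hi j hj => (hwp _ (hτ b).1 i (hIp i hi) j (hIp j hj)).trans <|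
      ((hτ b).2 i hi j hj).trans (he'e b b.2 i hi j hj)⟩

end IsHallGroup

/-- Finite partial isometries between two metric spaces, given by their graphs and ordered by
extension. -/
abbrev FinPartialIsometry (X Y : Type*) [MetricSpace X] [MetricSpace Y] : Type _ :=
  {R : Finset (X × Y) // ∀ p ∈ R, ∀ q ∈ R, dist p.1 q.1 = dist p.2 q.2}

namespace FinPartialIsometry

variable {X Y : Type*} [MetricSpace X] [MetricSpace Y]

theorem fst_eq_fst_iff (R : FinPartialIsometry X Y) {p q : X × Y} (hp : p ∈ R.1) (hq : q ∈ R.1) :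
    p.1 = q.1 ↔ p.2 = q.2 := by
  rw [← dist_eq_zero, R.2 p hp q hq, dist_eq_zero]

theorem exists_insert (R : FinPartialIsometry X Y) {x : X} {y : Y}
    (h : ∀ p ∈ R.1, dist x p.1 = dist y p.2) : ∃ S, R ≤ S ∧ (x, y) ∈ S.1 := by
  classical
  refine ⟨⟨insert (x, y) R.1, fun p hp q hq => ?_⟩, Finset.subset_insert _ _,
    Finset.mem_insert_self _ _⟩
  rcases Finset.mem_insert.1 hp with rfl | hp <;> rcases Finset.mem_insert.1 hq with rfl | hq
  · simp
  · exact h q hq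
  · rw [dist_comm, h p hp, dist_comm]
  · exact R.2 p hp q hq

theorem exists_swap (R : FinPartialIsometry X Y) :
    ∃ S : FinPartialIsometry Y X, ∀ p, p ∈ S.1 ↔ p.swap ∈ R.1 := by
  classical
  have mem_iff (p : Y × X) : p ∈ R.1.image Prod.swap ↔ p.swap ∈ R.1 :=
    Finset.mem_image.trans ⟨by rintro ⟨q, hq, rfl⟩; exact hq, fun hp => ⟨_, hp, p.swap_swap⟩⟩
  exact ⟨⟨R.1.image Prod.swap, fun p hp q hq =>
    (R.2 _ ((mem_iff p).1 hp) _ ((mem_iff q).1 hq)).symm⟩, mem_iff⟩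

/-- The forth property: finite partial isometries from `X` to `Y` extend to any further point. -/
def Forth (X Y : Type*) [MetricSpace X] [MetricSpace Y] : Prop :=
  ∀ (R : FinPartialIsometry X Y) (x : X), ∃ y, ∀ p ∈ R.1, dist x p.1 = dist y p.2

theorem Forth.isCofinal (h : Forth X Y) (x : X) :
    IsCofinal {R : FinPartialIsometry X Y | ∃ y, (x, y) ∈ R.1} := fun R => by
  obtain ⟨y, hy⟩ := h R x
  obtain ⟨S, hRS, hS⟩ := R.exists_insert hy
  exact ⟨S, ⟨y, hS⟩, hRS⟩

theorem Forth.isCofinal_swap (h : Forth Y X) (y : Y) :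
    IsCofinal {R : FinPartialIsometry X Y | ∃ x, (x, y) ∈ R.1} := fun R => by
  obtain ⟨R', hR'⟩ := R.exists_swap
  obtain ⟨x, hx⟩ := h R' y
  obtain ⟨S, hRS, hS⟩ := R.exists_insert fun p hp => (hx p.swap ((hR' _).2 hp)).symm
  exact ⟨S, ⟨x, hS⟩, hRS⟩

theorem exists_limit {𝓘 : Order.Ideal (FinPartialIsometry X Y)}
    (h : ∀ x, ∃ R, (∃ y, (x, y) ∈ R.1) ∧ R ∈ 𝓘) :
    ∃ F : X → Y, Isometry F ∧ ∀ R ∈ 𝓘, ∀ p ∈ R.1, F p.1 = p.2 := by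
  choose R F hF hR𝓘 using fun x => (h x).imp fun R hR => (⟨hR.1.choose, hR.1.choose_spec, hR.2⟩ :
    ∃ y, (x, y) ∈ R.1 ∧ R ∈ 𝓘)
  refine ⟨F, .of_dist_eq fun x y => ?_, fun S hS p hp => ?_⟩
  · obtain ⟨T, -, hxT, hyT⟩ := 𝓘.directed _ (hR𝓘 x) _ (hR𝓘 y)
    exact (T.2 (x, F x) (hxT (hF x)) (y, F y) (hyT (hF y))).symm
  · obtain ⟨T, -, hpT, hST⟩ := 𝓘.directed _ (hR𝓘 p.1) S hS
    exact (T.fst_eq_fst_iff (hpT (hF p.1)) (hST hp)).1 rfl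

theorem Forth.exists_isometry_extending [Countable X] (h : Forth X Y)
    (R : FinPartialIsometry X Y) : ∃ F : X → Y, Isometry F ∧ ∀ p ∈ R.1, F p.1 = p.2 := by
  have : Encodable X := Encodable.ofCountable X
  let 𝒟 (x : X) : Order.Cofinal (FinPartialIsometry X Y) := ⟨_, h.isCofinal x⟩
  obtain ⟨F, hF, F_eq⟩ := exists_limit (Order.cofinal_meets_idealOfCofinals R 𝒟)
  exact ⟨F, hF, F_eq R (Order.mem_idealOfCofinals R 𝒟)⟩

theorem Forth.nonempty_isometryEquiv [Countable X] [Countable Y] (h : Forth X Y)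
    (h' : Forth Y X) : Nonempty (X ≃ᵢ Y) := by
  have : Encodable (X ⊕ Y) := Encodable.ofCountable _
  let 𝒟 : X ⊕ Y → Order.Cofinal (FinPartialIsometry X Y) :=
    Sum.elim (fun x => ⟨_, h.isCofinal x⟩) fun y => ⟨_, h'.isCofinal_swap y⟩
  have meets := Order.cofinal_meets_idealOfCofinals ⟨∅, by simp⟩ 𝒟
  obtain ⟨F, hF, F_eq⟩ := exists_limit fun x => meets (.inl x)
  have surjective_F : Function.Surjective F := fun y => by
    obtain ⟨R, ⟨x, hx⟩, hR⟩ := meets (.inr y)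
    exact ⟨x, F_eq R hR _ hx⟩
  exact ⟨.mk (.ofBijective F ⟨hF.injective, surjective_F⟩) hF⟩

end FinPartialIsometry

/-- Every rational distance function from a finite nonempty set of points of `D` to one further
point (a positive Katětov function) is realized by a point of `D`. -/
def RealizesRationalKatetov (D : Type*) [MetricSpace D] : Prop :=
  ∀ (W : Set D) (f : D → ℚ), W.Finite → W.Nonempty → (∀ x ∈ W, 0 < f x) →
    (∀ x ∈ W, ∀ y ∈ W, (f x : ℝ) ≤ f y + dist y x) →
    (∀ x ∈ W, ∀ y ∈ W, dist x y ≤ (f x + f y : ℝ)) → ∃ z, ∀ x ∈ W, dist z x = f x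

theorem RealizesRationalKatetov.forth {D X : Type*} [MetricSpace D] [Nonempty D] [MetricSpace X]
    (hD : RealizesRationalKatetov D) (hX : HasRationalDistances X) :
    FinPartialIsometry.Forth X D := fun R x => by
  by_cases hx : ∃ y, (x, y) ∈ R.1
  · obtain ⟨y, hy⟩ := hx
    exact ⟨y, R.2 _ hy⟩
  rcases R.1.eq_empty_or_nonempty with hR | hR
  · exact ⟨Classical.arbitrary D, by simp [hR]⟩
  have exists_rat (d : D) : ∃ r : ℚ, ∀ p ∈ R.1, p.2 = d → r = dist x p.1 := by
    by_cases hd : ∃ p ∈ R.1, p.2 = d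
    · obtain ⟨p, hp, rfl⟩ := hd
      obtain ⟨r, hr⟩ := hX x p.1
      exact ⟨r, fun q hq hqp => by rw [← hr, (R.fst_eq_fst_iff hq hp).2 hqp]⟩
    · exact ⟨0, fun p hp hpd => absurd ⟨p, hp, hpd⟩ hd⟩
  choose f f_eq using exists_rat
  replace f_eq (p) (hp : p ∈ R.1) : (f p.2 : ℝ) = dist x p.1 := f_eq _ p hp rfl
  suffices ∃ z, ∀ d ∈ Prod.snd '' (R.1 : Set (X × D)), dist z d = f d by
    obtain ⟨z, hz⟩ := this
    exact ⟨z, fun p hp => (f_eq p hp).symm.trans (hz _ ⟨p, hp, rfl⟩).symm⟩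
  refine hD _ f (R.1.finite_toSet.image _) ((Finset.coe_nonempty.2 hR).image _) ?_ ?_ ?_
  · rintro _ ⟨p, hp, rfl⟩
    have dist_pos : 0 < dist x p.1 := dist_pos.2 fun h => hx ⟨p.2, h ▸ hp⟩
    exact_mod_cast (f_eq p hp).symm ▸ dist_pos
  · rintro _ ⟨p, hp, rfl⟩ _ ⟨q, hq, rfl⟩
    rw [f_eq p hp, f_eq q hq, ← R.2 q hq p hp]
    exact dist_triangle _ _ _
  · rintro _ ⟨p, hp, rfl⟩ _ ⟨q, hq, rfl⟩
    rw [f_eq p hp, f_eq q hq, ← R.2 p hp q hq]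
    exact dist_triangle_left _ _ _

theorem HasRationalDistances.of_isometry {X Y : Type*} [MetricSpace X] [MetricSpace Y]
    (hY : HasRationalDistances Y) {f : X → Y} (hf : Isometry f) : HasRationalDistances X :=
  fun x y => hf.dist_eq x y ▸ hY (f x) (f y)

namespace IsRationalUrysohnSpace

theorem of_isometryEquiv {X Y : Type*} [MetricSpace X] [MetricSpace Y] (e : X ≃ᵢ Y)
    (hX : IsRationalUrysohnSpace X) : IsRationalUrysohnSpace Y where
  countable := have := hX.countable; .of_equiv X e.toEquiv
  rational := hX.rational.of_isometry e.symm.isometry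
  extension A B _ _ _ _ hA hB ι ρ hι hρ := by
    obtain ⟨σ, hσ, hσι⟩ := hX.extension A B hA hB ι (e.symm ∘ ρ) hι (e.symm.isometry.comp hρ)
    exact ⟨e ∘ σ, e.isometry.comp hσ, by rw [Function.comp_assoc, hσι, ← Function.comp_assoc,
      e.self_comp_symm, Function.id_comp]⟩

theorem of_realizesRationalKatetov {D : Type*} [MetricSpace D] [Countable D] [Nonempty D]
    (hrat : HasRationalDistances D) (hD : RealizesRationalKatetov D) :
    IsRationalUrysohnSpace D where
  countable := inferInstance
  rational := hrat
  extension A B _ _ _ _ _ hB ι ρ hι hρ := by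
    classical
    have := Fintype.ofFinite A
    let R : FinPartialIsometry B D := ⟨Finset.univ.image fun a => (ι a, ρ a), by
      simp [hι.dist_eq, hρ.dist_eq]⟩
    obtain ⟨σ, hσ, hσR⟩ := (hD.forth hB).exists_isometry_extending R
    exact ⟨σ, hσ, funext fun a => hσR (ι a, ρ a) (Finset.mem_image_of_mem _ (Finset.mem_univ a))⟩

theorem exists_extension {D A B : Type*} [MetricSpace D] [MetricSpace A] [MetricSpace B]
    [Finite A] [Finite B] (hD : IsRationalUrysohnSpace D) (hB : HasRationalDistances B)
    {ι : A → B} {ρ : A → D} (hι : Isometry ι) (hρ : Isometry ρ) :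
    ∃ σ : B → D, Isometry σ ∧ ∀ a, σ (ι a) = ρ a := by
  let eA := equivShrink.{0} A
  let eB := equivShrink.{0} B
  let : MetricSpace (Shrink.{0} A) := .induced eA.symm eA.symm.injective inferInstance
  let : MetricSpace (Shrink.{0} B) := .induced eB.symm eB.symm.injective inferInstance
  have isometry_eA : Isometry eA.symm := .of_dist_eq fun _ _ => rfl
  have isometry_eB : Isometry eB.symm := .of_dist_eq fun _ _ => rfl
  have hfinA : Finite (Shrink.{0} A) := .of_equiv A eA
  have hfinB : Finite (Shrink.{0} B) := .of_equiv B eB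
  have isometry_eB' : Isometry eB := isometry_eB.right_inv eB.symm_apply_apply
  obtain ⟨σ, hσ, hσι⟩ := hD.extension _ _ (hB.of_isometry (hι.comp isometry_eA))
    (hB.of_isometry isometry_eB) (eB ∘ ι ∘ eA.symm) (ρ ∘ eA.symm)
    (isometry_eB'.comp (hι.comp isometry_eA)) (hρ.comp isometry_eA)
  exact ⟨σ ∘ eB, hσ.comp isometry_eB', fun a => by simpa using congrFun hσι (eA a)⟩

variable {X Y : Type*} [MetricSpace X] [MetricSpace Y]

theorem forth (hY : IsRationalUrysohnSpace Y) (hX : HasRationalDistances X) :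
    FinPartialIsometry.Forth X Y := fun R x => by
  classical
  have exists_pair (a : R.1.image Prod.fst) : ∃ y, ((a : X), y) ∈ R.1 := by
    obtain ⟨p, hp, hpa⟩ := Finset.mem_image.1 a.2
    exact ⟨p.2, hpa ▸ hp⟩
  choose ρ hρ using exists_pair
  obtain ⟨σ, hσ, σ_eq⟩ := hY.exists_extension (A := R.1.image Prod.fst)
    (B := (insert x (R.1.image Prod.fst) : Finset X)) (ρ := ρ)
    (ι := fun a => ⟨a, Finset.mem_insert_of_mem a.2⟩) (hX.of_isometry isometry_subtype_coe)
    (.of_dist_eq fun _ _ => rfl) (.of_dist_eq fun a b => (R.2 _ (hρ a) _ (hρ b)).symm)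
  refine ⟨σ ⟨x, Finset.mem_insert_self _ _⟩, fun p hp => ?_⟩
  have hp' := Finset.mem_image_of_mem Prod.fst hp
  have σ_fst : σ ⟨p.1, Finset.mem_insert_of_mem hp'⟩ = p.2 :=
    (σ_eq ⟨p.1, hp'⟩).trans ((R.fst_eq_fst_iff (hρ _) hp).1 rfl)
  rw [← σ_fst, hσ.dist_eq]
  rfl

theorem nonempty_isometryEquiv (hX : IsRationalUrysohnSpace X) (hY : IsRationalUrysohnSpace Y) :
    Nonempty (X ≃ᵢ Y) :=
  have := hX.countable
  have := hY.countable
  (hY.forth hX.rational).nonempty_isometryEquiv (hX.forth hY.rational)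

end IsRationalUrysohnSpace

theorem IsRationalUrysohnSpace.isUrysohnSpace_completion {D : Type*} [MetricSpace D]
    (hD : IsRationalUrysohnSpace D) : IsUrysohnSpace (UniformSpace.Completion D) where
  complete := inferInstance
  exists_dense := ⟨Set.range ((↑) : D → UniformSpace.Completion D),
    UniformSpace.Completion.denseRange_coe,
    hD.of_isometryEquiv UniformSpace.Completion.coe_isometry.isometryEquivOnRange⟩

theorem IsUrysohnSpace.exists_isometry_denseRange {U D : Type*} [MetricSpace U] [MetricSpace D]
    (hU : IsUrysohnSpace U) (hD : IsRationalUrysohnSpace D) :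
    ∃ i : D → U, Isometry i ∧ DenseRange i := by
  obtain ⟨D', hD'_dense, hD'⟩ := hU.exists_dense
  obtain ⟨e⟩ := hD.nonempty_isometryEquiv hD'
  exact ⟨Subtype.val ∘ e, isometry_subtype_coe.comp e.isometry, by
    rwa [DenseRange, e.surjective.range_comp, Subtype.range_coe]⟩

/-- The metric on `G × ι` given by an invariant metric. -/
abbrev IsInvMetric.metricSpace {G ι : Type*} [Group G] {w : G → ι → ι → ℚ}
    (hw : IsInvMetric w) : MetricSpace (G × ι) where
  dist x y := ((invDist w x y : ℚ) : ℝ)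
  dist_self x := by rw [hw.invDist_self trivial, Rat.cast_zero]
  dist_comm x y := by rw [hw.invDist_comm ⟨trivial, trivial⟩ ⟨trivial, trivial⟩]
  dist_triangle x y z := by
    exact_mod_cast hw.invDist_triangle (x := x) (y := y) (z := z) ⟨trivial, trivial⟩
      ⟨trivial, trivial⟩ ⟨trivial, trivial⟩
  eq_of_dist_eq_zero {x y} h := by
    have dist_eq_zero : invDist w x y = 0 := Rat.cast_eq_zero.1 h
    obtain ⟨h_fst, h_snd⟩ := hw.eq_zero_iff.1 dist_eq_zero
    exact Prod.ext (inv_mul_eq_one.1 h_fst) h_snd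

theorem IsGenericInvMetric.isRationalUrysohnSpace {G : Type*} [Group G] [Countable G]
    {w : G → ℕ → ℕ → ℚ} (hw : IsGenericInvMetric w) :
    @IsRationalUrysohnSpace (G × ℕ) hw.isInvMetric.metricSpace := by
  let := hw.isInvMetric.metricSpace
  have dist_eq (x y : G × ℕ) : dist x y = invDist w x y := rfl
  refine .of_realizesRationalKatetov (fun x y => ⟨_, dist_eq x y⟩)
    fun W f hW hne pos le_add dist_le => ?_
  have isKatetov_f : IsKatetov (⊥ : Subgroup G) 0 W w f :=
    { pos := pos
      le_add := fun x hx y hy => by exact_mod_cast dist_eq y x ▸ le_add x hx y hy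
      dist_le := fun x hx y hy => by exact_mod_cast dist_eq x y ▸ dist_le x hx y hy
      smul_mem := fun a ha x hx => by simpa [Subgroup.mem_bot.1 ha] using hx
      smul_le := fun a ha x _ => by simp [Subgroup.mem_bot.1 ha]
      norm_le := fun a ha x hx => by simpa [Subgroup.mem_bot.1 ha] using (pos x hx).le
      norm_eq_zero := by simp
      norm_inv := by simp
      norm_mul := by simp }
  obtain ⟨n, -, hn⟩ := hw.exists_orbit ⊥ 0 W f hW hne isKatetov_f
  exact ⟨(1, n), fun x hx => by rw [dist_eq, invDist_one_left, hn x hx]⟩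

theorem IsLocallyFiniteGroup.exists_exhaustion {H : Type*} [Group H] [Countable H]
    (hH : IsLocallyFiniteGroup H) :
    ∃ K : ℕ → Subgroup H, Monotone K ∧ K 0 = ⊥ ∧ (∀ n, Finite (K n)) ∧ ∀ h, ∃ n, h ∈ K n := by
  obtain ⟨enum, enum_surjective⟩ := exists_surjective_nat H
  refine ⟨fun n => Subgroup.closure (enum '' Set.Iio n), fun m n hmn =>
    Subgroup.closure_mono (Set.image_mono (Set.Iio_subset_Iio hmn)), by simp, fun n =>
    hH _ ⟨((Set.finite_Iio n).image enum).toFinset, by simp⟩, fun h => ?_⟩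
  obtain ⟨n, rfl⟩ := enum_surjective h
  exact ⟨n + 1, Subgroup.subset_closure ⟨n, n.lt_succ_self, rfl⟩⟩

theorem exists_monoidHom_of_exhaustion {H M : Type*} [Group H] [Group M]
    {K : ℕ → Subgroup H} (hK : Monotone K) (hcover : ∀ h, ∃ n, h ∈ K n) (τ : ∀ n, K n →* M)
    (hτ : ∀ n k, τ (n + 1) (Subgroup.inclusion (hK n.le_succ) k) = τ n k) :
    ∃ φ : H →* M, ∀ n (k : K n), φ k = τ n k := by
  have τ_of_le {m n} (hmn : m ≤ n) (k : K m) : τ n (Subgroup.inclusion (hK hmn) k) = τ m k := by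
    induction n, hmn using Nat.le_induction with
    | base => rfl
    | succ n hmn ih => exact (hτ n _).trans ih
  choose N hN using hcover
  have τ_N (n) (k : K n) : τ (N k) ⟨k, hN k⟩ = τ n k := by
    rw [← τ_of_le (le_max_left (N k) n), ← τ_of_le (le_max_right (N k) n)]
    rfl
  refine ⟨.mk' (fun h => τ (N h) ⟨h, hN h⟩) fun g h => ?_, τ_N⟩
  have mem_max (h) {n} (hn : N h ≤ n) : h ∈ K n := hK hn (hN h)
  have hg := mem_max g (le_max_left _ (N h))
  have hh := mem_max h (le_max_right (N g) _)
  rw [τ_N _ ⟨g, hg⟩, τ_N _ ⟨h, hh⟩, τ_N _ ⟨g * h, mul_mem hg hh⟩, ← map_mul]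
  rfl

/-- On `K × I`, the map `(k, i) ↦ (τ k, σ i)` is isometric from the invariant metric `v` to the
invariant metric `w`. -/
def IsInvIsometryOn {H G ι κ : Type*} [Group H] [Group G] {K : Subgroup H} (v : H → ι → ι → ℚ)
    (w : G → κ → κ → ℚ) (τ : K →* G) (σ : ι → κ) (I : Set ι) : Prop :=
  ∀ k : K, ∀ i ∈ I, ∀ j ∈ I, w (τ k) (σ i) (σ j) = v k i j

namespace IsInvIsometryOn

variable {H G ι κ : Type*} [Group H] [Group G] {K L : Subgroup H} {v : H → ι → ι → ℚ}
  {w : G → κ → κ → ℚ} {τ : K →* G} {σ : ι → κ} {I : Set ι}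

theorem hom_injective (h : IsInvIsometryOn v w τ σ I) (hv : IsInvMetric v) (hw : IsInvMetric w)
    (hI : I.Nonempty) : Function.Injective τ := by
  obtain ⟨i, hi⟩ := hI
  refine (injective_iff_map_eq_one τ).2 fun k hk => Subtype.ext ?_
  have v_eq_zero := (h k i hi i hi).symm.trans (hw.eq_zero_iff.2 ⟨hk, rfl⟩)
  exact (hv.eq_zero_iff.1 v_eq_zero).1

theorem injOn (h : IsInvIsometryOn v w τ σ I) (hv : IsInvMetric v) (hw : IsInvMetric w) :
    Set.InjOn σ I := fun i hi j hj hij => by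
  have v_eq_zero := (h 1 i hi j hj).symm.trans (hw.eq_zero_iff.2 ⟨map_one τ, hij⟩)
  exact (hv.eq_zero_iff.1 v_eq_zero).2

theorem congr (h : IsInvIsometryOn v w τ σ I) {σ' : ι → κ} (hσ : Set.EqOn σ' σ I) :
    IsInvIsometryOn v w τ σ' I := fun k i hi j hj => by
  rw [hσ hi, hσ hj, h k i hi j hj]

theorem insert (h : IsInvIsometryOn v w τ σ I) (hv : IsInvMetric v) (hw : IsInvMetric w) {c : ι}
    (hcc : ∀ k, w (τ k) (σ c) (σ c) = v k c c)
    (hci : ∀ k, ∀ i ∈ I, w (τ k) (σ c) (σ i) = v k c i) :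
    IsInvIsometryOn v w τ σ (insert c I) := by
  rintro k i (rfl | hi) j (rfl | hj)
  · exact hcc k
  · exact hci k j hj
  · rw [← hw.symm, ← hv.symm, ← map_inv]
    exact hci k⁻¹ i hi
  · exact h k i hi j hj

end IsInvIsometryOn

theorem IsInvMetric.exists_isInvIsometryOn {H G ι κ : Type*} [Group H] [Group G] {L : Subgroup H}
    {v : H → ι → ι → ℚ} (hv : IsInvMetric v) {ρ : L →* G} (hρ : Function.Injective ρ) {σ : ι → κ}
    {I : Set ι} (hσ : Set.InjOn σ I) :
    ∃ e, IsInvMetricOn ρ.range (σ '' I) e ∧ IsInvIsometryOn v e ρ σ I := by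
  have hvLI : IsInvMetricOn L I v := hv.mono le_top I.subset_univ
  obtain ⟨e, he, hev⟩ := hvLI.restrict.exists_transport hρ hσ.injective
  rw [Set.range_domRestrict] at he
  exact ⟨e, he, fun k i hi j hj => hev k ⟨i, hi⟩ ⟨j, hj⟩⟩

namespace IsGenericInvMetric

variable {H G ι : Type*} [Group H] [Group G] {K L : Subgroup H} {v : H → ι → ι → ℚ}
  {w : G → ℕ → ℕ → ℚ} {τ : K →* G} {σ : ι → ℕ} {I : Set ι}

theorem exists_extend_orbit [DecidableEq ι] [Finite K] (hw : IsGenericInvMetric w)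
    (hv : IsInvMetric v) (hI : I.Finite) (hne : I.Nonempty) {c : ι} (hc : c ∉ I)
    (h : IsInvIsometryOn v w τ σ I) :
    ∃ n, IsInvIsometryOn v w τ (Function.update σ c n) (insert c I) := by
  have update_eq (n : ℕ) : Set.EqOn (Function.update σ c n) σ I := fun i hi =>
    Function.update_of_ne (ne_of_mem_of_not_mem hi hc) _ _
  have hτ := h.hom_injective hv hw.isInvMetric hne
  obtain ⟨m, hm⟩ := (hI.image σ).infinite_compl.nonempty
  have injOn_update : Set.InjOn (Function.update σ c m) (insert c I) := by
    rw [Set.injOn_insert hc, (update_eq m).injOn_iff, (update_eq m).image_eq, Function.update_self]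
    exact ⟨h.injOn hv hw.isInvMetric, hm⟩
  obtain ⟨e, he, hev⟩ := hv.exists_isInvIsometryOn hτ injOn_update
  rw [Set.image_insert_eq, (update_eq m).image_eq, Function.update_self] at he
  have hevI : IsInvIsometryOn v e τ σ I := fun k i hi j hj => by
    rw [← hev k i (.inr hi) j (.inr hj), update_eq m hi, update_eq m hj]
  have isKatetov_w : IsKatetov τ.range (fun a => e a m m) {x | x.1 ∈ τ.range ∧ x.2 ∈ σ '' I} w
      fun x => e x.1 m x.2 := by
    refine (IsKatetov.of_isInvMetricOn he (Set.subset_insert _ _) (Set.mem_insert _ _) hm).congr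
      ?_ (fun _ _ => rfl) (fun _ _ => rfl)
    rintro ⟨_, _⟩ ⟨⟨a, rfl⟩, i, hi, rfl⟩ ⟨_, _⟩ ⟨⟨b, rfl⟩, j, hj, rfl⟩
    simp only [invDist, ← map_inv, ← map_mul]
    rw [h _ i hi j hj, hevI _ i hi j hj]
  have : Finite τ.range := Set.finite_range τ
  obtain ⟨n, hn, hnf⟩ := hw.exists_orbit τ.range _ _ _ ((Set.finite_range τ).prod (hI.image σ))
    ⟨(1, σ hne.some), one_mem τ.range, _, hne.some_mem, rfl⟩ isKatetov_w
  refine ⟨n, (h.congr (update_eq n)).insert hv hw.isInvMetric (fun k => ?_) fun k i hi => ?_⟩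
  · rw [Function.update_self, hn _ ⟨k, rfl⟩, ← hev k c (.inl rfl) c (.inl rfl),
      Function.update_self]
  · rw [Function.update_self, update_eq n hi, hnf (τ k, σ i) ⟨⟨k, rfl⟩, i, hi, rfl⟩,
      ← hev k c (.inl rfl) i (.inr hi), Function.update_self, update_eq m hi]

theorem exists_extend_group (hw : IsGenericInvMetric w) (hG : IsHallGroup G) [Finite L]
    (hv : IsInvMetric v) (hKL : K ≤ L) (hI : I.Finite) (hne : I.Nonempty)
    (h : IsInvIsometryOn v w τ σ I) :
    ∃ τ' : L →* G, (∀ k, τ' (Subgroup.inclusion hKL k) = τ k) ∧ IsInvIsometryOn v w τ' σ I := by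
  have : Finite K := .of_injective _ (Subgroup.inclusion_injective hKL)
  obtain ⟨ρ, hρ, hρτ⟩ := hG.exists_extension (Subgroup.inclusion_injective hKL)
    (h.hom_injective hv hw.isInvMetric hne)
  obtain ⟨e, he, hev⟩ := hv.exists_isInvIsometryOn hρ (h.injOn hv hw.isInvMetric)
  have : Finite ρ.range := Set.finite_range ρ
  obtain ⟨φ, hφ, hφe⟩ := hw.exists_hom τ.range ρ.range (σ '' I) e
    (by rintro _ ⟨k, rfl⟩; exact ⟨_, hρτ k⟩) (hI.image σ) (hne.image σ) he (by
      rintro _ ⟨k, rfl⟩ _ ⟨i, hi, rfl⟩ _ ⟨j, hj, rfl⟩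
      rw [h k i hi j hj, ← hρτ, hev _ i hi j hj]
      rfl)
  refine ⟨φ.comp ρ.rangeRestrict, fun k => ?_, fun k i hi j hj => ?_⟩
  · exact (hφ (ρ.rangeRestrict (Subgroup.inclusion hKL k)) ⟨k, (hρτ k).symm⟩).trans (hρτ k)
  · exact (hφe (ρ.rangeRestrict k) _ ⟨i, hi, rfl⟩ _ ⟨j, hj, rfl⟩).trans (hev k i hi j hj)

theorem exists_embedding {H : Type*} [Group H] [Countable H] {v : H → ℕ → ℕ → ℚ}
    (hw : IsGenericInvMetric w) (hG : IsHallGroup G) (hH : IsLocallyFiniteGroup H)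
    (hv : IsInvMetric v) :
    ∃ (τ : H →* G) (σ : ℕ → ℕ), ∀ h i j, w (τ h) (σ i) (σ j) = v h i j := by
  obtain ⟨K, hK, hK_zero, hK_fin, hK_cover⟩ := hH.exists_exhaustion
  let Stage (n : ℕ) := {x : (K n →* G) × (ℕ → ℕ) // IsInvIsometryOn v w x.1 x.2 (Set.Iic n)}
  have exists_next (n) (x : Stage n) : ∃ y : Stage (n + 1),
      (∀ k, y.1.1 (Subgroup.inclusion (hK n.le_succ) k) = x.1.1 k) ∧
        Set.EqOn y.1.2 x.1.2 (Set.Iic n) := by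
    obtain ⟨⟨τ, σ⟩, hτσ⟩ := x
    obtain ⟨c, hc⟩ := hw.exists_extend_orbit hv (Set.finite_Iic n) Set.nonempty_Iic
      (Set.notMem_Iic.2 n.lt_succ_self) hτσ
    obtain ⟨τ', hτ', hτ'σ⟩ := hw.exists_extend_group hG hv (hK n.le_succ)
      ((Set.finite_Iic n).insert _) (Set.insert_nonempty _ _) hc
    have Iic_succ : Set.Iic (n + 1) = insert (n + 1) (Set.Iic n) := Order.Iic_succ n
    exact ⟨⟨(τ', _), Iic_succ ▸ hτ'σ⟩, hτ', fun i hi =>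
      Function.update_of_ne (Nat.lt_succ_of_le hi).ne _ _⟩
  choose next next_hom next_idx using exists_next
  let x₀ : Stage 0 := ⟨(1, id), fun k i hi j hj => by
    have hk : (k : H) = 1 := by simpa [hK_zero] using k.2
    rw [Nat.le_zero.1 hi, Nat.le_zero.1 hj, hv.eq_zero_iff.2 ⟨hk, rfl⟩]
    exact hw.isInvMetric.eq_zero_iff.2 ⟨rfl, rfl⟩⟩
  let x (n : ℕ) : Stage n := Nat.rec x₀ next n
  obtain ⟨τ, hτ⟩ := exists_monoidHom_of_exhaustion hK hK_cover (fun n => (x n).1.1)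
    fun n => next_hom n (x n)
  have idx_of_le {i n} (hin : i ≤ n) : (x n).1.2 i = (x i).1.2 i := by
    induction n, hin using Nat.le_induction with
    | base => rfl
    | succ n hin ih => exact (next_idx n (x n) hin).trans ih
  refine ⟨τ, fun i => (x i).1.2 i, fun h i j => ?_⟩
  obtain ⟨n, hn⟩ := hK_cover h
  let m := max n (max i j)
  have hi : i ≤ m := le_max_of_le_right (le_max_left i j)
  have hj : j ≤ m := le_max_of_le_right (le_max_right i j)
  have hm : h ∈ K m := hK (le_max_left _ _) hn
  change w (τ h) ((x i).1.2 i) ((x j).1.2 j) = _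
  rw [← idx_of_le hi, ← idx_of_le hj, hτ m ⟨h, hm⟩]
  exact (x m).2 ⟨h, hm⟩ i hi j hj

end IsGenericInvMetric

theorem IsInvMetric.tower {H ι : Type*} [Group H] {D : ℕ → H → ι → ι → ℚ} {c : ℕ → ℚ}
    (hD : ∀ m, IsInvMetric (D m)) (hc : StrictAnti c)
    (hD_anti : ∀ {k m}, k ≤ m → ∀ h p q, D m h p q ≤ D k h p q)
    (hD_le : ∀ {k m}, k ≤ m → ∀ h p q, D k h p q ≤ D m h p q + 2 * (c k - c m)) :
    IsInvMetric fun h (x y : ι × ℕ) => |c x.2 - c y.2| + D (max x.2 y.2) h x.1 y.1 := by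
  refine .mk (fun h ⟨p, i⟩ ⟨q, j⟩ => ?_) (fun h ⟨p, i⟩ ⟨q, j⟩ => ?_)
    fun h h' ⟨p, i⟩ ⟨q, j⟩ ⟨r, k⟩ => ?_
  · have D_nonneg : 0 ≤ D (max i j) h p q :=
      (hD _).nonneg (Subgroup.mem_top _) (Set.mem_univ _) (Set.mem_univ _)
    rw [add_eq_zero_iff_of_nonneg (abs_nonneg _) D_nonneg, abs_eq_zero, sub_eq_zero,
      hc.injective.eq_iff, (hD _).eq_zero_iff, Prod.mk.injEq]
    tauto
  · simp only [abs_sub_comm, max_comm, (hD _).symm]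
  · dsimp only
    have D_triangle (m) : D m (h * h') p r ≤ D m h p q + D m h' q r := (hD m).triangle ..
    rcases le_total j (max i k) with hj | hj
    · have := hD_anti (max_le (le_max_left i k) hj) h p q
      have := hD_anti (max_le hj (le_max_right i k)) h' q r
      linarith [D_triangle (max i k), abs_sub_le (c i) (c j) (c k)]
    · have hij := (le_max_left i k).trans hj
      have hkj := (le_max_right i k).trans hj
      have abs_sub : |c i - c k| + 2 * (c (max i k) - c j) = (c i - c j) + (c k - c j) := by
        rw [hc.antitone.map_max, ← max_sub_min_eq_abs']
        linarith [min_add_max (c i) (c k)]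
      rw [max_eq_right hij, max_eq_left hkj, abs_of_nonneg (sub_nonneg.2 (hc.antitone hij)),
        abs_sub_comm (c j), abs_of_nonneg (sub_nonneg.2 (hc.antitone hkj))]
      linarith [D_triangle j, hD_le hj (h * h') p r]

/-- The least multiple of `2⁻ᵐ` that is at least `t`. -/
noncomputable def dyadicCeil (m : ℕ) (t : ℝ) : ℚ := (⌈2 ^ m * t⌉ : ℚ) / 2 ^ m

section dyadicCeil

variable (m : ℕ) (s t : ℝ)

@[simp]
theorem dyadicCeil_zero : dyadicCeil m 0 = 0 := by simp [dyadicCeil]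

theorem le_dyadicCeil : t ≤ dyadicCeil m t := by
  rw [dyadicCeil, Rat.cast_div, Rat.cast_intCast, Rat.cast_pow, Rat.cast_ofNat,
    le_div_iff₀' (by positivity)]
  exact Int.le_ceil _

theorem dyadicCeil_le : (dyadicCeil m t : ℝ) ≤ t + (1 / 2) ^ m := by
  rw [dyadicCeil, Rat.cast_div, Rat.cast_intCast, Rat.cast_pow, Rat.cast_ofNat,
    div_le_iff₀' (by positivity), mul_add, ← mul_pow, mul_one_div_cancel two_ne_zero, one_pow]
  exact (Int.ceil_lt_add_one _).le

theorem dyadicCeil_mono : Monotone (dyadicCeil m) := fun s t h => by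
  unfold dyadicCeil
  gcongr

theorem dyadicCeil_nonneg {t : ℝ} (ht : 0 ≤ t) : 0 ≤ dyadicCeil m t :=
  (dyadicCeil_zero m).symm.trans_le (dyadicCeil_mono m ht)

theorem dyadicCeil_add_le : dyadicCeil m (s + t) ≤ dyadicCeil m s + dyadicCeil m t := by
  unfold dyadicCeil
  rw [← add_div, mul_add]
  gcongr
  exact_mod_cast Int.ceil_add_le _ _

theorem dyadicCeil_antitone {k m : ℕ} (h : k ≤ m) : dyadicCeil m t ≤ dyadicCeil k t := by
  obtain ⟨d, rfl⟩ := Nat.exists_eq_add_of_le h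
  have ceil_le : ⌈(2 : ℝ) ^ (k + d) * t⌉ ≤ 2 ^ d * ⌈(2 : ℝ) ^ k * t⌉ := by
    rw [Int.ceil_le, pow_add, mul_comm ((2 : ℝ) ^ k), mul_assoc]
    push_cast
    gcongr
    exact Int.le_ceil _
  calc dyadicCeil (k + d) t
      ≤ (2 ^ d * ⌈(2 : ℝ) ^ k * t⌉ : ℚ) / 2 ^ (k + d) := by
        unfold dyadicCeil
        gcongr
        exact_mod_cast ceil_le
    _ = dyadicCeil k t := by
        rw [pow_add, mul_comm ((2 : ℚ) ^ k), mul_div_mul_left _ _ (by positivity), dyadicCeil]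

end dyadicCeil

open Classical in
/-- An invariant rational metric approximating the orbits of the points `y i` under an isometric
action up to `2 * 2⁻ᵐ`. The summand `2⁻ᵐ` off the diagonal separates the points, so that the
approximating action is free even if the given one is not. -/
noncomputable def approxDist {H Y ι : Type*} [Group H] [PseudoMetricSpace Y] (β : H →* (Y ≃ᵢ Y))
    (y : ι → Y) (m : ℕ) (h : H) (i j : ι) : ℚ :=
  dyadicCeil m (dist (y i) (β h (y j))) + if h = 1 ∧ i = j then 0 else (1 / 2) ^ m

section approxDist

variable {H Y ι : Type*} [Group H] [PseudoMetricSpace Y] (β : H →* (Y ≃ᵢ Y)) (y : ι → Y)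

theorem approxDist_one_self (m : ℕ) (i : ι) : approxDist β y m 1 i i = 0 := by
  simp [approxDist]

theorem dist_le_approxDist (m : ℕ) (h : H) (i j : ι) :
    dist (y i) (β h (y j)) ≤ approxDist β y m h i j := by
  have le_ceil := le_dyadicCeil m (dist (y i) (β h (y j)))
  have pow_pos : (0 : ℝ) < (1 / 2) ^ m := by positivity
  unfold approxDist
  split_ifs <;> push_cast <;> linarith

theorem approxDist_le (m : ℕ) (h : H) (i j : ι) :
    (approxDist β y m h i j : ℝ) ≤ dist (y i) (β h (y j)) + 2 * (1 / 2) ^ m := by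
  have ceil_le := dyadicCeil_le m (dist (y i) (β h (y j)))
  have pow_pos : (0 : ℝ) < (1 / 2) ^ m := by positivity
  unfold approxDist
  split_ifs <;> push_cast <;> linarith

theorem approxDist_antitone {k m : ℕ} (hkm : k ≤ m) (h : H) (i j : ι) :
    approxDist β y m h i j ≤ approxDist β y k h i j := by
  refine add_le_add (dyadicCeil_antitone _ hkm) ?_
  split_ifs
  · rfl
  · exact pow_le_pow_of_le_one (by norm_num) (by norm_num) hkm

theorem approxDist_le_approxDist_add {k m : ℕ} (hkm : k ≤ m) (h : H) (i j : ι) :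
    approxDist β y k h i j ≤
      approxDist β y m h i j + 2 * (2 * (1 / 2) ^ k - 2 * (1 / 2) ^ m) := by
  rcases hkm.eq_or_lt with rfl | hlt
  · simp
  have le_add : approxDist β y k h i j ≤ approxDist β y m h i j + 2 * (1 / 2) ^ k := by
    rw [← Rat.cast_le (K := ℝ)]
    push_cast
    linarith [approxDist_le β y k h i j, dist_le_approxDist β y m h i j]
  have pow_le : (1 / 2 : ℚ) ^ m ≤ (1 / 2) ^ (k + 1) :=
    pow_le_pow_of_le_one (by norm_num) (by norm_num) hlt
  rw [pow_succ] at pow_le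
  linarith

theorem isInvMetric_approxDist (m : ℕ) : IsInvMetric (approxDist β y m) := by
  refine .mk (fun h i j => ⟨fun h_eq => ?_, ?_⟩) (fun h i j => ?_) fun h h' i j k => ?_
  · by_contra hne
    have ceil_nonneg := dyadicCeil_nonneg m (dist_nonneg (x := y i) (y := β h (y j)))
    rw [approxDist, if_neg hne] at h_eq
    linarith [show (0 : ℚ) < (1 / 2) ^ m by positivity]
  · rintro ⟨rfl, rfl⟩
    exact approxDist_one_self β y m i
  · have dist_inv : dist (y j) (β h⁻¹ (y i)) = dist (y i) (β h (y j)) := by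
      rw [← (β h).dist_eq, map_inv, IsometryEquiv.apply_inv_self, dist_comm]
    have diag_iff : h⁻¹ = 1 ∧ j = i ↔ h = 1 ∧ i = j := by rw [inv_eq_one, eq_comm (a := j)]
    rw [approxDist, approxDist, dist_inv]
    congr! 2
  · by_cases hij : h = 1 ∧ i = j
    · obtain ⟨rfl, rfl⟩ := hij
      rw [one_mul, approxDist_one_self, zero_add]
    have dist_mul : dist (y i) (β (h * h') (y k)) ≤
        dist (y i) (β h (y j)) + dist (y j) (β h' (y k)) := by
      rw [map_mul, IsometryEquiv.mul_apply, ← (β h).dist_eq (y j)]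
      exact dist_triangle ..
    have ceil_mul := (dyadicCeil_mono m dist_mul).trans (dyadicCeil_add_le m _ _)
    have pow_pos : (0 : ℚ) < (1 / 2) ^ m := by positivity
    unfold approxDist
    rw [if_neg hij]
    split_ifs <;> linarith

theorem exists_isInvMetric_approx :
    ∃ v : H → ι × ℕ → ι × ℕ → ℚ, IsInvMetric v ∧
      (∀ i k l, (v 1 (i, k) (i, l) : ℝ) ≤ 2 * (1 / 2) ^ min k l) ∧
      ∀ h i j k, dist (y i) (β h (y j)) ≤ v h (i, k) (j, k) ∧
        (v h (i, k) (j, k) : ℝ) ≤ dist (y i) (β h (y j)) + 2 * (1 / 2) ^ k := by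
  let c (m : ℕ) : ℚ := 2 * (1 / 2) ^ m
  have hc : StrictAnti c := fun a b h =>
    mul_lt_mul_of_pos_left (pow_lt_pow_right_of_lt_one₀ (by norm_num) (by norm_num) h) two_pos
  have c_nonneg (m) : 0 ≤ c m := by positivity
  refine ⟨_, .tower (isInvMetric_approxDist β y) hc (approxDist_antitone β y)
    (approxDist_le_approxDist_add β y), fun i k l => ?_, fun h i j k => ?_⟩
  · have abs_le : |c k - c l| ≤ c (min k l) := by
      rw [hc.antitone.map_min, ← max_sub_min_eq_abs']
      exact sub_le_self _ (le_min (c_nonneg k) (c_nonneg l))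
    rw [approxDist_one_self, add_zero]
    exact (Rat.cast_le.2 abs_le).trans_eq (by simp [c])
  · rw [sub_self, abs_zero, max_self, zero_add]
    exact ⟨dist_le_approxDist β y k h i j, approxDist_le β y k h i j⟩

end approxDist

theorem exists_isometry_extending {α X Z : Type*} [MetricSpace X] [MetricSpace Z]
    [CompleteSpace Z] {a : α → X} (ha : DenseRange a) {b : α → Z}
    (dist_eq : ∀ x y, dist (b x) (b y) = dist (a x) (a y)) :
    ∃ F : X → Z, Isometry F ∧ ∀ x, F (a x) = b x := by
  let : PseudoMetricSpace α := .induced a inferInstance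
  have isUniformInducing_a : IsUniformInducing a := ⟨rfl⟩
  have isDenseInducing_a := isUniformInducing_a.isDenseInducing ha
  have uniformContinuous_b : UniformContinuous b := (Isometry.of_dist_eq dist_eq).uniformContinuous
  have extend_eq (x) : isDenseInducing_a.extend b (a x) = b x :=
    uniformly_extend_of_ind isUniformInducing_a ha uniformContinuous_b x
  have : Continuous (isDenseInducing_a.extend b) :=
    (uniformContinuous_uniformly_extend isUniformInducing_a ha uniformContinuous_b).continuous
  refine ⟨isDenseInducing_a.extend b, .of_dist_eq fun x y => ?_, extend_eq⟩
  refine ha.induction_on₂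
    (p := fun x y => dist (isDenseInducing_a.extend b x) (isDenseInducing_a.extend b y) = dist x y)
    (isClosed_eq (by fun_prop) (by fun_prop)) (fun x y => ?_) x y
  rw [extend_eq, extend_eq, dist_eq]

theorem exists_isometric_action {G ι U : Type*} [Group G] [MetricSpace U] [CompleteSpace U]
    {w : G → ι → ι → ℚ} {i : G × ι → U} (hi : DenseRange i)
    (dist_eq : ∀ x y, dist (i x) (i y) = invDist w x y) :
    ∃ γ : G →* (U ≃ᵢ U), ∀ g x, γ g (i x) = i (g * x.1, x.2) := by
  have exists_translation (g : G) : ∃ F : U → U, Isometry F ∧ ∀ x, F (i x) = i (g * x.1, x.2) :=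
    exists_isometry_extending hi fun x y => by rw [dist_eq, dist_eq, invDist_smul]
  choose F hF F_apply using exists_translation
  have F_mul (g h : G) : F (g * h) = F g ∘ F h :=
    hi.equalizer (hF _).continuous ((hF g).continuous.comp (hF h).continuous) <| funext fun x => by
      simp only [Function.comp_apply, F_apply, mul_assoc]
  have F_one : F 1 = id :=
    hi.equalizer (hF _).continuous continuous_id <| funext fun x => by
      simp only [Function.comp_apply, F_apply, one_mul, Prod.mk.eta, id]
  let e (g : G) : U ≃ᵢ U :=
    { toFun := F g
      invFun := F g⁻¹
      left_inv := congrFun (by rw [← F_mul, inv_mul_cancel, F_one] : F g⁻¹ ∘ F g = id)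
      right_inv := congrFun (by rw [← F_mul, mul_inv_cancel, F_one] : F g ∘ F g⁻¹ = id)
      isometry_toFun := hF g }
  exact ⟨.mk' e fun g h => IsometryEquiv.ext (congrFun (F_mul g h)), F_apply⟩

theorem dist_apply_apply_eq_dist_inv_mul {H X : Type*} [Group H] [PseudoMetricSpace X]
    (φ : H →* (X ≃ᵢ X)) (g h : H) (x y : X) : dist (φ g x) (φ h y) = dist x (φ (g⁻¹ * h) y) := by
  rw [← (φ g).dist_eq x, ← IsometryEquiv.mul_apply, ← map_mul, mul_inv_cancel_left]

theorem exists_equivariant_isometry_extending {H ι Y U : Type*} [Group H] [MetricSpace Y]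
    [MetricSpace U] [CompleteSpace U] {β : H →* (Y ≃ᵢ Y)} {γ : H →* (U ≃ᵢ U)} {y : ι → Y}
    (hy : DenseRange y) {z : ι → U}
    (dist_eq : ∀ h p q, dist (z p) (γ h (z q)) = dist (y p) (β h (y q))) :
    ∃ F : Y → U, Isometry F ∧ ∀ h x, F (β h x) = γ h (F x) := by
  have hdense : DenseRange fun a : H × ι => β a.1 (y a.2) := by
    refine hy.mono ?_
    rintro _ ⟨p, rfl⟩
    exact ⟨(1, p), by simp⟩
  obtain ⟨F, hF, F_apply⟩ := exists_isometry_extending hdense (b := fun a => γ a.1 (z a.2))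
    fun a b => by simp only [dist_apply_apply_eq_dist_inv_mul, dist_eq]
  refine ⟨F, hF, fun h => congrFun <| hdense.equalizer (hF.continuous.comp (β h).continuous)
    ((γ h).continuous.comp hF.continuous) <| funext fun a => ?_⟩
  have orbit_mul : β h (β a.1 (y a.2)) = β (h * a.1) (y a.2) := by
    rw [map_mul, IsometryEquiv.mul_apply]
  calc F (β h (β a.1 (y a.2))) = γ (h * a.1) (z a.2) := by rw [orbit_mul, F_apply (h * a.1, a.2)]
    _ = γ h (F (β a.1 (y a.2))) := by rw [map_mul, IsometryEquiv.mul_apply, F_apply]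

theorem IsInvMetric.comp_injective {H ι κ : Type*} [Group H] {v : H → ι → ι → ℚ}
    (hv : IsInvMetric v) {f : κ → ι} (hf : Function.Injective f) :
    IsInvMetric fun h i j => v h (f i) (f j) :=
  .mk (fun h i j => by rw [hv.eq_zero_iff, hf.eq_iff]) (fun h i j => hv.symm h _ _)
    fun g h i j k => hv.triangle g h _ _ _

namespace IsGenericInvMetric

variable {G : Type*} [Group G] {w : G → ℕ → ℕ → ℚ}

theorem exists_injective_embedding {H ι : Type*} [Group H] [Countable H] [Denumerable ι]
    {v : H → ι → ι → ℚ} (hw : IsGenericInvMetric w) (hG : IsHallGroup G)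
    (hH : IsLocallyFiniteGroup H) (hv : IsInvMetric v) :
    ∃ (τ : H →* G) (σ : ι → ℕ), Function.Injective τ ∧
      ∀ h i j, w (τ h) (σ i) (σ j) = v h i j := by
  let e := Denumerable.eqv ι
  obtain ⟨τ, σ, hτσ⟩ := hw.exists_embedding hG hH (hv.comp_injective e.symm.injective)
  refine ⟨τ, σ ∘ e, (injective_iff_map_eq_one τ).2 fun h hh => ?_, fun h i j => ?_⟩
  · have := hτσ h 0 0
    rw [hh, hw.isInvMetric.eq_zero_iff.2 ⟨rfl, rfl⟩, eq_comm, hv.eq_zero_iff] at this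
    exact this.1
  · simp only [Function.comp_apply, hτσ, e.symm_apply_apply]

theorem exists_equivariant_isometry {H Y U : Type*} [Group H] [Countable H] [MetricSpace Y]
    [Nonempty Y] [TopologicalSpace.SeparableSpace Y] [MetricSpace U] [CompleteSpace U]
    (hw : IsGenericInvMetric w) (hG : IsHallGroup G) {i : G × ℕ → U}
    (dist_eq : ∀ x y, dist (i x) (i y) = invDist w x y) {γ : G →* (U ≃ᵢ U)}
    (hγ : ∀ g x, γ g (i x) = i (g * x.1, x.2)) (hH : IsLocallyFiniteGroup H)
    (β : H →* (Y ≃ᵢ Y)) :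
    ∃ (τ : H →* G) (F : Y → U), Function.Injective τ ∧ Isometry F ∧
      ∀ h y, F (β h y) = γ (τ h) (F y) := by
  let y := TopologicalSpace.denseSeq Y
  obtain ⟨v, hv, v_one_le, v_approx⟩ := exists_isInvMetric_approx β y
  obtain ⟨τ, σ, hτ, hτσ⟩ := hw.exists_injective_embedding hG hH hv
  let x (p k : ℕ) : U := i (1, σ (p, k))
  have dist_x (h p q k l) : dist (x p k) (γ (τ h) (x q l)) = v h (p, k) (q, l) := by
    rw [hγ, dist_eq, mul_one, invDist_one_left, hτσ]
  have tendsto_error : Tendsto (fun k : ℕ => 2 * (1 / 2 : ℝ) ^ k) atTop (𝓝 0) := by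
    simpa only [mul_zero] using
      (tendsto_pow_atTop_nhds_zero_of_lt_one (one_half_pos (α := ℝ)).le one_half_lt_one).const_mul 2
  have cauchySeq_x (p) : CauchySeq (x p) := by
    refine cauchySeq_of_le_tendsto_0 _ (fun k l N hk hl => ?_) tendsto_error
    calc dist (x p k) (x p l) = v 1 (p, k) (p, l) := by
          rw [← dist_x, map_one, map_one]
          rfl
      _ ≤ 2 * (1 / 2) ^ min k l := v_one_le p k l
      _ ≤ 2 * (1 / 2) ^ N := by
          gcongr 2 * ?_
          exact pow_le_pow_of_le_one one_half_pos.le one_half_lt_one.le (le_min hk hl)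
  choose z hz using fun p => cauchySeq_tendsto_of_complete (cauchySeq_x p)
  have dist_z (h p q) : dist (z p) (γ (τ h) (z q)) = dist (y p) (β h (y q)) := by
    refine tendsto_nhds_unique
      ((hz p).dist (((γ (τ h)).continuous.tendsto _).comp (hz q))) ?_
    refine tendsto_of_tendsto_of_tendsto_of_le_of_le tendsto_const_nhds
      (by simpa only [add_zero] using tendsto_error.const_add (dist (y p) (β h (y q))))
      (fun k => ?_) (fun k => ?_)
    · exact (v_approx h p q k).1.trans_eq (dist_x h p q k k).symm
    · exact (dist_x h p q k k).trans_le (v_approx h p q k).2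
  obtain ⟨F, hF, F_equivariant⟩ := exists_equivariant_isometry_extending (γ := γ.comp τ)
    (TopologicalSpace.denseRange_denseSeq Y) dist_z
  exact ⟨τ, F, hτ, hF, F_equivariant⟩

end IsGenericInvMetric

theorem IsHallGroup.exists_universal_isometric_action {G U : Type*} [Group G] [MetricSpace U]
    (hG : IsHallGroup G) (hU : IsUrysohnSpace U) :
    ∃ γ : G →* (U ≃ᵢ U), ∀ (H : Type*) [Group H] [Countable H], IsLocallyFiniteGroup H →
      ∀ (Y : Type*) [MetricSpace Y] [Nonempty Y] [TopologicalSpace.SeparableSpace Y]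
        (β : H →* (Y ≃ᵢ Y)), ∃ (τ : H →* G) (F : Y → U), Function.Injective τ ∧ Isometry F ∧
          ∀ h y, F (β h y) = γ (τ h) (F y) := by
  have := hG.countable
  have := hU.complete
  obtain ⟨w, hw⟩ := hG.exists_isGenericInvMetric
  let := hw.isInvMetric.metricSpace
  obtain ⟨i, hi, hi_dense⟩ := hU.exists_isometry_denseRange hw.isRationalUrysohnSpace
  obtain ⟨γ, hγ⟩ := exists_isometric_action hi_dense hi.dist_eq
  exact ⟨γ, fun H _ _ hH Y _ _ _ β => hw.exists_equivariant_isometry hG hi.dist_eq hγ hH β⟩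

namespace LipZero

variable {X : Type*} [MetricSpace X] {o : X}

/-- Precomposition with an isometry, followed by the subtraction of a constant because the isometry
need not fix the base point. -/
noncomputable def compIsometry (T : X ≃ᵢ X) : LipZero X o →L[ℝ] LipZero X o :=
  LinearMap.mkContinuous
    { toFun f := ⟨fun x => f (T x) - f (T o), sub_self _, ⟨‖f‖, norm_nonneg f⟩,
        LipschitzWith.of_dist_le_mul fun x y => by
          rw [dist_sub_right, Real.dist_eq, ← T.dist_eq x y]
          exact f.abs_sub_le _ _⟩
      map_add' f g := ext_apply fun x => add_sub_add_comm ..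
      map_smul' c f := ext_apply fun x => (mul_sub ..).symm } 1 fun f => by
    rw [one_mul]
    refine norm_le (norm_nonneg f) fun x y => ?_
    rw [← T.dist_eq x y]
    change |f (T x) - f (T o) - (f (T y) - f (T o))| ≤ _
    rw [sub_sub_sub_cancel_right]
    exact f.abs_sub_le _ _

theorem norm_compIsometry_le (T : X ≃ᵢ X) : ‖(compIsometry T : LipZero X o →L[ℝ] _)‖ ≤ 1 :=
  LinearMap.mkContinuous_norm_le _ zero_le_one _

theorem compIsometry_one : (compIsometry 1 : LipZero X o →L[ℝ] _) = .id ℝ _ :=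
  ContinuousLinearMap.ext fun f => ext_apply fun x => by
    change f x - f o = f x
    rw [apply_base, sub_zero]

theorem compIsometry_mul (S T : X ≃ᵢ X) :
    (compIsometry (S * T) : LipZero X o →L[ℝ] _) = (compIsometry T).comp (compIsometry S) :=
  ContinuousLinearMap.ext fun f => ext_apply fun _ => (sub_sub_sub_cancel_right _ _ (f (S o))).symm

theorem eval_comp_compIsometry (T : X ≃ᵢ X) (x : X) :
    (eval o x).comp (compIsometry T) = eval o (T x) - eval o (T o) := rfl

theorem norm_eval_sub (x y : X) : ‖eval o x - eval o y‖ = dist x y := by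
  refine le_antisymm (ContinuousLinearMap.opNorm_le_bound _ dist_nonneg fun f => ?_) ?_
  · rw [mul_comm]
    exact f.abs_sub_le x y
  · let f : LipZero X o := ⟨fun z => dist z y - dist o y, sub_self _, 1,
      LipschitzWith.of_dist_le_mul fun a b => by
        rw [dist_sub_right, NNReal.coe_one, one_mul]
        exact abs_dist_sub_le a b y⟩
    have norm_f_le : ‖f‖ ≤ 1 := norm_le zero_le_one fun a b => by
      change |dist a y - dist o y - (dist b y - dist o y)| ≤ _
      rw [sub_sub_sub_cancel_right, one_mul]
      exact abs_dist_sub_le a b y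
    have eval_sub_f : (eval o x - eval o y) f = dist x y := by
      change dist x y - dist o y - (dist y y - dist o y) = dist x y
      rw [sub_sub_sub_cancel_right, dist_self, sub_zero]
    calc dist x y = ‖(eval o x - eval o y) f‖ := by
          rw [eval_sub_f, Real.norm_of_nonneg dist_nonneg]
      _ ≤ ‖eval o x - eval o y‖ := ContinuousLinearMap.unit_le_opNorm _ _ norm_f_le

end LipZero

namespace LipschitzFreeSpace

open LipZero

variable {X : Type*} [MetricSpace X] {o : X}

theorem comp_compIsometry_mem (T : X ≃ᵢ X) {φ : StrongDual ℝ (LipZero X o)}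
    (hφ : φ ∈ (Submodule.span ℝ (Set.range (eval o))).topologicalClosure) :
    φ.comp (compIsometry T) ∈ (Submodule.span ℝ (Set.range (eval o))).topologicalClosure := by
  let pullback := (ContinuousLinearMap.compL ℝ _ _ ℝ).flip (compIsometry (o := o) T)
  refine Submodule.topologicalClosure_minimal (t := Submodule.comap pullback.toLinearMap _) _
    (Submodule.span_le.2 ?_) (.preimage pullback.continuous
      (Submodule.isClosed_topologicalClosure _)) hφ
  rintro _ ⟨x, rfl⟩
  have pullback_eval : pullback (eval o x) = eval o (T x) - eval o (T o) :=
    eval_comp_compIsometry T x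
  exact Submodule.le_topologicalClosure _ (pullback_eval ▸
    sub_mem (Submodule.subset_span ⟨_, rfl⟩) (Submodule.subset_span ⟨_, rfl⟩))

/-- The canonical embedding of a metric space into its Lipschitz-free space. -/
noncomputable def embed (o x : X) : LipschitzFreeSpace X o :=
  ⟨eval o x, subset_closure (Submodule.subset_span ⟨x, rfl⟩)⟩

theorem isometry_embed : Isometry (embed o) :=
  Isometry.of_dist_eq fun x y => (dist_eq_norm (eval o x) (eval o y)).trans (norm_eval_sub x y)

/-- The linear endomorphism of the Lipschitz-free space induced by an isometry, by functoriality
after identifying the free spaces for the base points `o` and `T o`. -/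
noncomputable def linearMap (T : X ≃ᵢ X) :
    LipschitzFreeSpace X o →ₗ[ℝ] LipschitzFreeSpace X o where
  toFun φ := ⟨φ.1.comp (compIsometry T), comp_compIsometry_mem T φ.2⟩
  map_add' _ _ := rfl
  map_smul' _ _ := rfl

theorem linearMap_one : (linearMap 1 : LipschitzFreeSpace X o →ₗ[ℝ] _) = .id :=
  LinearMap.ext fun φ => Subtype.ext <| by
    change φ.1.comp (compIsometry 1) = φ.1
    rw [compIsometry_one, ContinuousLinearMap.comp_id]

theorem linearMap_mul (S T : X ≃ᵢ X) :
    (linearMap (S * T) : LipschitzFreeSpace X o →ₗ[ℝ] _) = linearMap S ∘ₗ linearMap T :=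
  LinearMap.ext fun φ => Subtype.ext <| by
    change φ.1.comp (compIsometry (S * T)) = (φ.1.comp (compIsometry T)).comp (compIsometry S)
    rw [compIsometry_mul, ContinuousLinearMap.comp_assoc]

theorem linearMap_embed (T : X ≃ᵢ X) (x : X) :
    linearMap T (embed o x) = embed o (T x) - embed o (T o) := rfl

theorem norm_linearMap_le (T : X ≃ᵢ X) (φ : LipschitzFreeSpace X o) : ‖linearMap T φ‖ ≤ ‖φ‖ :=
  (ContinuousLinearMap.opNorm_comp_le _ _).trans
    (mul_le_of_le_one_right (norm_nonneg _) (norm_compIsometry_le T))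

/-- The linear isometry of the Lipschitz-free space induced by an isometry. -/
noncomputable def linearIsometryEquiv (T : X ≃ᵢ X) :
    LipschitzFreeSpace X o ≃ₗᵢ[ℝ] LipschitzFreeSpace X o where
  toLinearEquiv := LinearEquiv.ofLinearMap (linearMap T) (linearMap T⁻¹)
    (by rw [← linearMap_mul, mul_inv_cancel, linearMap_one])
    (by rw [← linearMap_mul, inv_mul_cancel, linearMap_one])
  norm_map' φ := by
    refine le_antisymm (norm_linearMap_le T φ) ?_
    calc ‖φ‖ = ‖linearMap T⁻¹ (linearMap T φ)‖ := by
          rw [← LinearMap.comp_apply, ← linearMap_mul, inv_mul_cancel, linearMap_one,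
            LinearMap.id_apply]
      _ ≤ ‖linearMap T φ‖ := norm_linearMap_le T⁻¹ _

/-- The affine action of the isometry group on the Lipschitz-free space, for which the canonical
embedding is equivariant: `T` acts with linear part `linearMap T` and sends `0` to `embed o (T o)`.
-/
noncomputable def affineAction (o : X) :
    (X ≃ᵢ X) →* AffineIsometryGroup (LipschitzFreeSpace X o) :=
  MonoidHom.mk' (fun T => (linearIsometryEquiv T).toAffineIsometryEquiv.trans
    (AffineIsometryEquiv.constVAdd ℝ _ (embed o (T o)))) fun S T => by
    ext1 φ
    change embed o (S (T o)) + linearMap (S * T) φ =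
      embed o (S o) + linearMap S (embed o (T o) + linearMap T φ)
    rw [map_add, linearMap_embed, linearMap_mul, LinearMap.comp_apply]
    abel

theorem affineAction_embed (T : X ≃ᵢ X) (x : X) :
    affineAction o T (embed o x) = embed o (T x) := by
  change embed o (T o) + linearMap T (embed o x) = _
  rw [linearMap_embed]
  abel

end LipschitzFreeSpace

/-- The stages of the construction of Hall's group: each is the symmetric group on the previous
one. -/
def HallStage : ℕ → Type
  | 0 => Perm (Fin 3)
  | n + 1 => Perm (HallStage n)

namespace HallStage

instance group : ∀ n, Group (HallStage n)
  | 0 => inferInstanceAs (Group (Perm (Fin 3)))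
  | n + 1 => inferInstanceAs (Group (Perm (HallStage n)))

instance finite : ∀ n, Finite (HallStage n)
  | 0 => inferInstanceAs (Finite (Perm (Fin 3)))
  | n + 1 => have := finite n; inferInstanceAs (Finite (Perm (HallStage n)))

theorem card_succ (n : ℕ) : Nat.card (HallStage (n + 1)) = (Nat.card (HallStage n)).factorial :=
  Nat.card_perm

theorem add_three_le_card (n : ℕ) : n + 3 ≤ Nat.card (HallStage n) := by
  induction n with
  | zero =>
    have card_zero : Nat.card (HallStage 0) = Nat.factorial 3 := by
      rw [HallStage, Nat.card_perm, Nat.card_fin]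
    rw [card_zero]
    decide
  | succ n ih =>
    rw [card_succ]
    have := Nat.lt_factorial_self (show 3 ≤ Nat.card (HallStage n) by lia)
    lia

theorem dvd_card {k n : ℕ} (hk : 0 < k) (hkn : k ≤ n) : k ∣ Nat.card (HallStage n) := by
  obtain ⟨m, rfl⟩ := Nat.exists_eq_add_of_lt (hk.trans_le hkn)
  rw [zero_add] at hkn ⊢
  rw [card_succ]
  exact Nat.dvd_factorial hk (by linarith [add_three_le_card m])

/-- The Cayley embedding of a stage of Hall's group into the next one. -/
def cayley (n : ℕ) : HallStage n →* HallStage (n + 1) :=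
  MulAction.toPermHom (HallStage n) (HallStage n)

theorem actsFreely_cayley (n : ℕ) : ActsFreely (E := HallStage n) (cayley n) :=
  fun g e h => (mul_eq_right (a := g) (b := e)).1 h

theorem cayley_injective (n : ℕ) : Function.Injective (cayley n) :=
  (actsFreely_cayley n).injective

/-- The embeddings between the stages of Hall's group, composed from the Cayley embeddings. -/
def map (i j : ℕ) (h : i ≤ j) : HallStage i →* HallStage j :=
  Nat.leRec (motive := fun j _ => HallStage i →* HallStage j) (MonoidHom.id _)
    (fun j _ g => (cayley j).comp g) h

theorem map_self (i : ℕ) : map i i le_rfl = MonoidHom.id _ := Nat.leRec_self _ _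

theorem map_succ {i j : ℕ} (h : i ≤ j) :
    map i (j + 1) (h.trans j.le_succ) = (cayley j).comp (map i j h) :=
  Nat.leRec_succ _ _ _

theorem map_injective (i j : ℕ) (h : i ≤ j) : Function.Injective (map i j h) := by
  induction j, h using Nat.le_induction with
  | base => rw [map_self]; exact Function.injective_id
  | succ j h ih =>
    rw [map_succ h]
    exact (cayley_injective j).comp ih

instance directedSystem : DirectedSystem HallStage (map · · ·) where
  map_self i x := by rw [map_self, MonoidHom.id_apply]
  map_map k j i hij hjk x := by
    induction k, hjk using Nat.le_induction with
    | base => rw [map_self, MonoidHom.id_apply]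
    | succ k hjk ih =>
      rw [map_succ hjk, map_succ (hij.trans hjk), MonoidHom.comp_apply, MonoidHom.comp_apply, ih]

end HallStage

/-- The direct limit of the stages; it is a model of Hall's group. -/
abbrev HallLimit : Type := DirectLimit HallStage HallStage.map

namespace HallLimit

/-- The embedding of a stage into the direct limit. -/
noncomputable def ofStage (n : ℕ) : HallStage n →* HallLimit :=
  MonoidHom.mk' (fun x => Quotient.mk _ ⟨n, x⟩) fun x y =>
    (DirectLimit.mul_def (G := HallStage) (f := HallStage.map) n x y).symm

theorem ofStage_injective (n : ℕ) : Function.Injective (ofStage n) :=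
  DirectLimit.mk_injective _ HallStage.map_injective n

theorem ofStage_map {i j : ℕ} (h : i ≤ j) (x : HallStage i) :
    ofStage j (HallStage.map i j h x) = ofStage i x :=
  DirectLimit.mk_apply (F := HallStage) (f := HallStage.map) i j x h

theorem ofStage_cayley (n : ℕ) (x : HallStage n) :
    ofStage (n + 1) (HallStage.cayley n x) = ofStage n x := by
  have map_eq_cayley : HallStage.map n (n + 1) n.le_succ = HallStage.cayley n := by
    rw [HallStage.map_succ le_rfl, HallStage.map_self, MonoidHom.comp_id]
  rw [← map_eq_cayley]
  exact ofStage_map n.le_succ x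

theorem range_ofStage_mono : Monotone fun n => (ofStage n).range := by
  rintro i j h _ ⟨x, rfl⟩
  exact ⟨_, ofStage_map h x⟩

theorem exists_subset_range {s : Set HallLimit} (hs : s.Finite) (N : ℕ) :
    ∃ n, N ≤ n ∧ s ⊆ (ofStage n).range := by
  induction s, hs using Set.Finite.induction_on with
  | empty => exact ⟨N, le_rfl, Set.empty_subset _⟩
  | @insert a s _ _ ih =>
    obtain ⟨n, hn, hsn⟩ := ih
    obtain ⟨i, x, rfl⟩ := DirectLimit.exists_eq_mk _ a
    refine ⟨max n i, hn.trans (le_max_left _ _), Set.insert_subset ?_ ?_⟩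
    · exact range_ofStage_mono (le_max_right n i) ⟨x, rfl⟩
    · exact hsn.trans (range_ofStage_mono (le_max_left n i))

theorem exists_ofStage_comp_eq {A : Type*} [Group A] [Finite A] (ρ : A →* HallLimit) (N : ℕ) :
    ∃ n, N ≤ n ∧ ∃ ρ' : A →* HallStage n, (ofStage n).comp ρ' = ρ := by
  obtain ⟨n, hNn, hn⟩ := exists_subset_range (Set.finite_range ρ) N
  let ε := MonoidHom.ofInjective (ofStage_injective n)
  refine ⟨n, hNn, ε.symm.toMonoidHom.comp (ρ.codRestrict _ fun a => hn ⟨a, rfl⟩),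
    MonoidHom.ext fun a => ?_⟩
  exact congrArg Subtype.val (ε.apply_symm_apply ⟨ρ a, hn ⟨a, rfl⟩⟩)

instance countable : Countable HallLimit :=
  inferInstanceAs (Countable (Quotient (DirectLimit.setoid HallStage.map)))

theorem isLocallyFiniteGroup : IsLocallyFiniteGroup HallLimit := by
  rintro K ⟨S, rfl⟩
  obtain ⟨n, -, hn⟩ := exists_subset_range S.finite_toSet 0
  have : Finite (ofStage n).range := Set.finite_range (ofStage n)
  exact .of_injective _ (Subgroup.inclusion_injective ((Subgroup.closure_le _).2 hn))

theorem isHallGroup : IsHallGroup HallLimit where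
  countable := countable
  locallyFinite := isLocallyFiniteGroup
  extension A B _ _ _ _ ι ρ hι hρ := by
    obtain ⟨n, hBn, ρ', rfl⟩ := exists_ofStage_comp_eq ρ (Nat.card B)
    have hρ' : Function.Injective ρ' := Function.Injective.of_comp (f := ofStage n) hρ
    obtain ⟨σ, hσ, σ_free⟩ := ((HallStage.actsFreely_cayley n).comp hρ').exists_extension hι
      (HallStage.dvd_card Nat.card_pos hBn)
    refine ⟨(ofStage (n + 1)).comp σ, (ofStage_injective _).comp σ_free.injective,
      MonoidHom.ext fun a => ?_⟩
    change ofStage (n + 1) (σ (ι a)) = ofStage n (ρ' a)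
    rw [hσ]
    exact ofStage_cayley n (ρ' a)

end HallLimit

theorem mainTheorem10_general :
    (∃ (G : Type) (_ : Group G), IsHallGroup G) ∧
    (∃ (U : Type) (_ : MetricSpace U), IsUrysohnSpace U) ∧
    ∀ (G : Type*) [Group G] (U : Type*) [MetricSpace U] (o : U),
      IsHallGroup G → IsUrysohnSpace U →
      ∃ α : G →* AffineIsometryGroup (LipschitzFreeSpace U o),
        ∀ (H : Type*) [Group H] [Countable H], IsLocallyFiniteGroup H →
        ∀ (Y : Type*) [MetricSpace Y] [Nonempty Y] [TopologicalSpace.SeparableSpace Y]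
          (β : H →* (Y ≃ᵢ Y)),
          ∃ (H' : Subgroup G) (e : H ≃* H') (j : Y → LipschitzFreeSpace U o),
            Isometry j ∧ ∀ (h : H) (y : Y), j (β h y) = α (e h : G) (j y) := by
  refine ⟨⟨HallLimit, inferInstance, HallLimit.isHallGroup⟩, ?_, ?_⟩
  · obtain ⟨w, hw⟩ := HallLimit.isHallGroup.exists_isGenericInvMetric
    let := hw.isInvMetric.metricSpace
    exact ⟨_, _, hw.isRationalUrysohnSpace.isUrysohnSpace_completion⟩
  · intro G _ U _ o hG hU
    obtain ⟨γ, hγ⟩ := hG.exists_universal_isometric_action hU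
    refine ⟨(LipschitzFreeSpace.affineAction o).comp γ, fun H _ _ hH Y _ _ _ β => ?_⟩
    obtain ⟨τ, F, hτ, hF, F_equivariant⟩ := hγ H hH Y β
    refine ⟨τ.range, MonoidHom.ofInjective hτ, LipschitzFreeSpace.embed o ∘ F,
      LipschitzFreeSpace.isometry_embed.comp hF, fun h y => ?_⟩
    rw [Function.comp_apply, F_equivariant, Function.comp_apply, MonoidHom.comp_apply,
      MonoidHom.ofInjective_apply, LipschitzFreeSpace.affineAction_embed]

theorem mainTheorem10 :
    (∃ (G : Type) (_ : Group G), IsHallGroup G) ∧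
    (∃ (U : Type) (_ : MetricSpace U), IsUrysohnSpace U) ∧
    ∀ (G : Type*) [Group G] (U : Type*) [MetricSpace U] (o : U),
      IsHallGroup G → IsUrysohnSpace U →
      ∃ α : G →* AffineIsometryGroup (LipschitzFreeSpace U o),
        ∀ (H : Type*) [Group H] [Countable H], IsLocallyFiniteGroup H →
        ∀ (Y : Type*) [NormedAddCommGroup Y] [NormedSpace ℝ Y] [CompleteSpace Y]
          [TopologicalSpace.SeparableSpace Y] (β : H →* (Y ≃ᵢ Y)),
          ∃ (H' : Subgroup G) (e : H ≃* H') (j : Y → LipschitzFreeSpace U o),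
            Isometry j ∧ ∀ (h : H) (y : Y), j (β h y) = α (e h : G) (j y) := by
  obtain ⟨hall, urysohn, action⟩ := mainTheorem10_general
  exact ⟨hall, urysohn, fun G _ U _ o hG hU => (action G U o hG hU).imp
    fun α hα H _ _ hH Y _ _ _ _ β => hα H hH Y β⟩
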